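/- **Setting.** A pointed metric measure (p.m.m.) space is $(X,d,m,\bar x)$ with $(X,d)$ a complete separable geodesic metric space, $m$ a non-zero Borel measure, finite on bounded sets and with full support, and $\bar x\in X$. Let $\mathcal X_n=(X_n,d_n,m_n,\bar x_n)$, $n\in\mathbb N\cup\{\infty\}$, be p.m.m. spaces such that $\mathcal X_n\to\mathcal X_\infty$ in the pointed measured Gromov sense, realized by isometric embeddings $\iota_n:X_n\to Z$ into a complete separable metric space $Z$: $\iota_n(\bar x_n)\to\iota_\infty(\bar x_\infty)$ and $\int\varphi\,d(\iota_n)_\#m_n\to\int\varphi\,d(\iota_\infty)_\#m_\infty$ for all $\varphi\in C_{bs}(Z)$ (bounded continuous functions with bounded support). Identify $X_n$ with $\iota_n(X_n)$. *$L^2$-convergence.* $f_n\in L^2(m_n)$ converges weakly to $f_\infty\in L^2(m_\infty)$ if $\sup_n\|f_n\|_{L^2(m_n)}<\infty$ and $\int\varphi f_n\,dm_n\to\int\varphi f_\infty\,dm_\infty$ for all $\varphi\in C_{bs}(Z)$; strongly if moreover $\limsup_n\|f_n\|^2_{L^2(m_n)}\le\|f_\infty\|^2_{L^2(m_\infty)}$.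 The same definitions are used along subsequences. *Forms.* For each $n\in\mathbb N\cup\{\infty\}$ let $(\mathcal E_n,\mathcal F_n)$ be a coercive closed form on $L^2(m_n)$: $\mathcal F_n$ is a dense linear subspace, $\mathcal E_n$ is a bilinear form on $\mathcal F_n$ with $\mathcal E_n(f,f)\ge0$; writing $\mathcal E^n_\alpha(f,g)=\mathcal E_n(f,g)+\alpha(f,g)_{L^2(m_n)}$ and $\tilde{\mathcal E}^n_1$ for the symmetric part of $\mathcal E^n_1$, there is $C_n\ge1$ (which may depend on $n$) with $|\mathcal E^n_1(f,g)|\le C_n\,\mathcal E^n_1(f,f)^{1/2}\mathcal E^n_1(g,g)^{1/2}$ on $\mathcal F_n$; and $(\mathcal F_n,\tilde{\mathcal E}^n_1)$ is a Hilbert space. Put $\tilde{\mathcal E}_1^n(f)=\mathcal E^n_1(f,f)$ and $$\Phi_n(f)=\sup\{\mathcal E^n_1(g,f):\ g\in\mathcal F_n,\ \tilde{\mathcal E}^n_1(g)^{1/2}=1\}\quad(f\in\mathcal F_n);$$ both $\Phi_n$ and $\tilde{\mathcal E}^n_1$ are set to $\infty$ outside $\mathcal F_n$. Let $G^n_\alpha$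 ($\alpha>0$) be the resolvent, $G^n_\alpha f\in\mathcal F_n$ and $\mathcal E^n_\alpha(G^n_\alpha f,g)=(f,g)$ for all $g\in\mathcal F_n$, and $T^n_t$ ($t\ge0$) the strongly continuous contraction semigroup with $G^n_\alpha f=\int_0^\infty e^{-\alpha t}T^n_tf\,dt$. *Conditions.* * **(F1)** If $f_n\in L^2(m_n)$ converges weakly to $f_\infty\in L^2(m_\infty)$ and $\liminf_n\Phi_n(f_n)<\infty$, then $f_\infty\in\mathcal F_\infty$. * **(F2)** For all $f_n\in\mathcal F_n$ converging weakly to $f_\infty\in\mathcal F_\infty$ and all $w_\infty\in\mathcal F_\infty$ there are $w_n\in\mathcal F_n$ converging strongly to $w_\infty$ with $\lim_n\mathcal E_n(w_n,f_n)=\mathcal E_\infty(w_\infty,f_\infty)$. * **(F2$'$)** For all strictly increasing $(n_k)$ and all $f_k\in L^2(m_{n_k})$ converging weakly to $f_\infty\in\mathcal F_\infty$ with $\sup_k\Phi_{n_k}(f_k)<\infty$ there is a set $\mathcal C\subset\mathcal F_\infty$, dense for $(\tilde{\mathcal E}^\infty_1)^{1/2}$, such that every $w\in\mathcal C$ has $w_k\in\mathcal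 F_{n_k}$ converging strongly to $w$ with $\liminf_k\mathcal E_{n_k}(w_k,f_k)\le\mathcal E_\infty(w,f_\infty)$. * **(F1$_*$)**, **(F2$'_*$)**: (F1), (F2$'$) with $\Phi_n(\cdot)$ replaced by $\tilde{\mathcal E}^n_1(\cdot)^{1/2}$. * **(R)** Whenever $f_n\to f_\infty$ strongly, $G^n_\alpha f_n\to G^\infty_\alpha f_\infty$ strongly for every $\alpha>0$. * **(S)** Whenever $f_n\to f_\infty$ strongly, $T^n_tf_n\to T^\infty_tf_\infty$ strongly for every $t\ge0$, uniformly on every $[0,T]$, that is, $\int\varphi\,T^n_tf_n\,dm_n\to\int\varphi\,T^\infty_tf_\infty\,dm_\infty$ for each $\varphi\in C_{bs}(Z)$ and $\|T^n_tf_n\|\to\|T^\infty_tf_\infty\|$, uniformly in $t\in[0,T]$. **Theorem.** (i) $\big[(F1)\text{ and }(F2)\big]\iff\big[(F1)\text{ and }(F2')\big]\iff(R)\iff(S)$. (ii) $\big[(F1_*)\text{ and }(F2'_*)\big]\implies(R)$. -/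

import Mathlib

open Filter Topology MeasureTheory
open scoped ENNReal

section HilleYosida
variable {H : Type*} [NormedAddCommGroup H] [NormedSpace ℝ H]

/-- `(T_t)_{t ≥ 0}` is a strongly continuous semigroup of contractions. -/
structure IsContractionSemigroup (T : ℝ → H →L[ℝ] H) : Prop where
  zero : T 0 = 1
  add : ∀ s t : ℝ, 0 ≤ s → 0 ≤ t → T (s + t) = T s * T t
  norm_le : ∀ t : ℝ, 0 ≤ t → ‖T t‖ ≤ 1
  continuousOn : ∀ f : H, ContinuousOn (fun t => T t f) (Set.Ici 0)

theorem norm_opExp_le (B : H →L[ℝ] H) : ‖NormedSpace.exp B‖ ≤ Real.exp ‖B‖ := by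
  have h2 : HasSum (fun n : ℕ => ((n.factorial : ℝ)⁻¹) • ‖B‖ ^ n) (Real.exp ‖B‖) := by
    rw [Real.exp_eq_exp_ℝ]
    exact NormedSpace.exp_series_hasSum_exp' (𝕂 := ℝ) ‖B‖
  rw [NormedSpace.exp_eq_tsum ℝ]
  refine tsum_of_norm_bounded h2 fun n => ?_
  rw [norm_smul, norm_inv, Real.norm_natCast, smul_eq_mul]
  gcongr
  rcases n with _ | n
  · rw [pow_zero, pow_zero]
    exact (ContinuousLinearMap.norm_id_le (𝕜 := ℝ) (E := H))
  · exact norm_pow_le' B n.succ_pos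

variable [CompleteSpace H]

theorem opExp_add {A B : H →L[ℝ] H} (h : Commute A B) :
    NormedSpace.exp (A + B) = NormedSpace.exp A * NormedSpace.exp B := by
  let _ : NormedAlgebra ℚ (H →L[ℝ] H) := NormedAlgebra.restrictScalars ℚ ℝ _
  exact NormedSpace.exp_add_of_commute h

theorem norm_opExp_sub_le (B : H →L[ℝ] H) (c : ℝ) (h : ‖B‖ ≤ c) :
    ‖NormedSpace.exp (B - c • (1 : H →L[ℝ] H))‖ ≤ 1 := by
  have hc : NormedSpace.exp (-(c • (1 : H →L[ℝ] H))) = Real.exp (-c) • (1 : H →L[ℝ] H) := by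
    have := NormedSpace.algebraMap_exp_comm (𝕂 := ℝ) (𝔸 := H →L[ℝ] H) (-c)
    rw [← Real.exp_eq_exp_ℝ, Algebra.algebraMap_eq_smul_one, Algebra.algebraMap_eq_smul_one] at this
    rw [this, neg_smul]
  rw [sub_eq_add_neg, opExp_add (((Commute.one_right B).smul_right c).neg_right), hc,
    mul_smul_comm, mul_one, norm_smul, Real.norm_of_nonneg (Real.exp_pos _).le]
  calc Real.exp (-c) * ‖NormedSpace.exp B‖ ≤ Real.exp (-c) * Real.exp c := by
        gcongr
        exact (norm_opExp_le B).trans (Real.exp_le_exp.2 h)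
    _ = 1 := by rw [← Real.exp_add]; simp

theorem hasDerivAt_opExp (A : H →L[ℝ] H) (f : H) (t : ℝ) :
    HasDerivAt (fun s : ℝ => NormedSpace.exp (s • A) f) (NormedSpace.exp (t • A) (A f)) t := by
  have h := (hasDerivAt_exp_smul_const (𝕂 := ℝ) A t).clm_apply (hasDerivAt_const t f)
  simpa using h

theorem norm_opExp_sub_opExp_le {A B : H →L[ℝ] H} (hAB : Commute A B)
    (hA : ∀ t : ℝ, 0 ≤ t → ‖NormedSpace.exp (t • A)‖ ≤ 1)
    (hB : ∀ t : ℝ, 0 ≤ t → ‖NormedSpace.exp (t • B)‖ ≤ 1) (f : H) (t : ℝ) (ht : 0 ≤ t) :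
    ‖NormedSpace.exp (t • A) f - NormedSpace.exp (t • B) f‖ ≤ t * ‖A f - B f‖ := by
  have hd : ∀ s : ℝ, HasDerivAt
      (fun s : ℝ => NormedSpace.exp (s • A) (NormedSpace.exp ((t - s) • B) f))
      (NormedSpace.exp (s • A) (NormedSpace.exp ((t - s) • B) (A f - B f))) s := by
    intro s
    have h1 := (hasDerivAt_opExp B f (t - s)).scomp s ((hasDerivAt_id s).const_sub t)
    have h2 := (hasDerivAt_exp_smul_const (𝕂 := ℝ) A s).clm_apply h1
    refine h2.congr_deriv ?_
    have hc : Commute A (NormedSpace.exp ((t - s) • B)) :=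
      (hAB.smul_right (t - s)).exp_right
    have hc' : A (NormedSpace.exp ((t - s) • B) f) = NormedSpace.exp ((t - s) • B) (A f) :=
      congrArg (fun L : H →L[ℝ] H => L f) hc.eq
    change NormedSpace.exp (s • A) (A (NormedSpace.exp ((t - s) • B) f)) +
      NormedSpace.exp (s • A) ((-1 : ℝ) • NormedSpace.exp ((t - s) • B) (B f)) = _
    rw [hc', neg_one_smul, map_neg, map_sub, map_sub, ← sub_eq_add_neg]
  have := norm_image_sub_le_of_norm_deriv_le_segment' (a := 0) (b := t) (C := ‖A f - B f‖)
    (fun s _ => (hd s).hasDerivWithinAt) (fun s hs => ?_) t ⟨ht, le_rfl⟩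
  · simpa [mul_comm] using this
  · calc _ ≤ ‖NormedSpace.exp (s • A)‖ * (‖NormedSpace.exp ((t - s) • B)‖ * ‖A f - B f‖) :=
          (ContinuousLinearMap.le_opNorm _ _).trans
            (mul_le_mul_of_nonneg_left (ContinuousLinearMap.le_opNorm _ _) (norm_nonneg _))
      _ ≤ 1 * (1 * ‖A f - B f‖) := by
          gcongr
          · exact hA s hs.1
          · exact hB _ (sub_nonneg.2 hs.2.le)
      _ = _ := by ring

/-- Hille--Yosida: a strongly continuous contraction resolvent is the Laplace transform of a
strongly continuous contraction semigroup. -/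
theorem exists_contractionSemigroup (G : ℝ → H →L[ℝ] H)
    (hres : ∀ α β : ℝ, 0 < α → 0 < β → ∀ f, G α f - G β f = (β - α) • G α (G β f))
    (hbd : ∀ α : ℝ, 0 < α → ∀ f, ‖α • G α f‖ ≤ ‖f‖)
    (hlim : ∀ f, Tendsto (fun α : ℝ => α • G α f) atTop (𝓝 f)) :
    ∃ T : ℝ → H →L[ℝ] H, IsContractionSemigroup T ∧
      ∀ α : ℝ, 0 < α → ∀ f, G α f = ∫ t in Set.Ioi 0, Real.exp (-α * t) • T t f := by
  have hcomm : ∀ α β : ℝ, 0 < α → 0 < β → ∀ f, G α (G β f) = G β (G α f) := by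
    intro α β hα hβ f
    rcases eq_or_ne α β with rfl | hne
    · rfl
    have h1 := hres α β hα hβ f
    have h2 := hres β α hβ hα f
    have h3 : (β - α) • (G α (G β f) - G β (G α f)) = 0 := by
      rw [smul_sub, ← h1, show β - α = -(α - β) by ring, neg_smul, ← h2]; abel
    exact sub_eq_zero.1 ((smul_eq_zero.1 h3).resolve_left (sub_ne_zero.2 hne.symm))
  set b : ℕ → ℝ := fun n => n + 1 with hb
  have hb0 : ∀ n, 0 < b n := fun n => by positivity
  have hbt : Tendsto b atTop atTop := tendsto_atTop_add_const_right _ _ tendsto_natCast_atTop_atTop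
  set A : ℕ → H →L[ℝ] H := fun n => (b n) ^ 2 • G (b n) - (b n) • (1 : H →L[ℝ] H) with hA
  have hAcomm : ∀ n m, Commute (A n) (A m) := by
    intro n m
    have : Commute (G (b n)) (G (b m)) := by
      ext f; exact hcomm _ _ (hb0 n) (hb0 m) f
    exact (((this.smul_left _).smul_right _).sub_right ((Commute.one_right _).smul_right _)).sub_left
      ((Commute.one_left _).smul_left _)
  have hG : ∀ α : ℝ, 0 < α → ‖G α‖ ≤ α⁻¹ := by
    intro α hα
    refine ContinuousLinearMap.opNorm_le_bound _ (by positivity) fun f => ?_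
    have := hbd α hα f
    rw [norm_smul, Real.norm_of_nonneg hα.le] at this
    rw [← div_eq_inv_mul, le_div_iff₀ hα]; linarith
  set S : ℕ → ℝ → H →L[ℝ] H := fun n t => NormedSpace.exp (t • A n) with hS
  have hS1 : ∀ n t, 0 ≤ t → ‖S n t‖ ≤ 1 := by
    intro n t ht
    have : t • A n = (t * (b n) ^ 2) • G (b n) - (t * b n) • (1 : H →L[ℝ] H) := by
      simp only [hA, smul_sub, smul_smul]
    simp only [hS, this]
    apply norm_opExp_sub_le
    rw [norm_smul, Real.norm_of_nonneg (by positivity)]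
    calc t * b n ^ 2 * ‖G (b n)‖ ≤ t * b n ^ 2 * (b n)⁻¹ := by
          gcongr; exact hG _ (hb0 n)
      _ = t * b n := by field_simp [(hb0 n).ne']
  have hAG : ∀ α : ℝ, 0 < α → ∀ n h, A n (G α h) = b n • G (b n) (α • G α h - h) := by
    intro α hα n h
    have h1 := hres α (b n) hα (hb0 n) h
    rw [hcomm _ _ hα (hb0 n)] at h1
    have h2 : b n • G (b n) (G α h) = G α h - G (b n) h + α • G (b n) (G α h) := by
      rw [h1, sub_smul]; abel
    simp only [hA, sub_apply, smul_apply, one_apply_eq_self, map_sub, map_smul]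
    rw [pow_two, mul_smul, h2]
    simp only [smul_sub, smul_add]; abel
  have hAGlim : ∀ α : ℝ, 0 < α → ∀ h,
      Tendsto (fun n => A n (G α h)) atTop (𝓝 (α • G α h - h)) := by
    intro α hα h
    simp only [hAG α hα]
    exact (hlim _).comp hbt
  -- contraction on vectors
  have hSv : ∀ n t, 0 ≤ t → ∀ f, ‖S n t f‖ ≤ ‖f‖ := fun n t ht f =>
    ((S n t).le_of_opNorm_le (hS1 n t ht) f).trans_eq (one_mul _)
  -- local uniform Cauchy property
  have hUC : ∀ f (R : ℝ), 0 < R → ∀ ε > 0, ∃ N, ∀ n ≥ N, ∀ m ≥ N, ∀ t ∈ Set.Icc 0 R,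
      dist (S n t f) (S m t f) < ε := by
    intro f R hR ε hε
    obtain ⟨β, hβ, hβ0⟩ := (((hlim f).eventually (Metric.ball_mem_nhds f (half_pos (half_pos hε)))).and
      (eventually_gt_atTop 0)).exists
    set g := G β (β • f) with hg
    have hgf : ‖f - g‖ < ε / 2 / 2 := by
      rw [hg, map_smul, ← dist_eq_norm, dist_comm]; exact hβ
    obtain ⟨N, hN⟩ := Metric.cauchySeq_iff.1 (hAGlim β hβ0 (β • f)).cauchySeq (ε / 2 / R) (by positivity)
    refine ⟨N, fun n hn m hm t ht => ?_⟩
    have h1 := norm_opExp_sub_opExp_le (hAcomm n m) (fun t ht => hS1 n t ht)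
      (fun t ht => hS1 m t ht) g t ht.1
    have h2 := hN n hn m hm
    rw [dist_eq_norm] at h2 ⊢
    have h3 : S n t f - S m t f = S n t (f - g) + (S n t g - S m t g) - S m t (f - g) := by
      simp only [map_sub]; abel
    have h4 : t * ‖A n g - A m g‖ ≤ ε / 2 := by
      calc t * ‖A n g - A m g‖ ≤ R * (ε / 2 / R) := by
            gcongr
            exact ht.2
        _ = ε / 2 := by field_simp
    calc ‖S n t f - S m t f‖ ≤ ‖S n t (f - g)‖ + ‖S n t g - S m t g‖ + ‖S m t (f - g)‖ := by
          rw [h3]; exact (norm_sub_le _ _).trans (add_le_add_left (norm_add_le _ _) _)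
      _ ≤ ‖f - g‖ + ε / 2 + ‖f - g‖ := by
          gcongr
          · exact hSv n t ht.1 _
          · exact h1.trans h4
          · exact hSv m t ht.1 _
      _ < ε := by linarith
  have hcau : ∀ t, 0 ≤ t → ∀ f, CauchySeq fun n => S n t f := by
    intro t ht f
    refine Metric.cauchySeq_iff.2 fun ε hε => ?_
    obtain ⟨N, hN⟩ := hUC f (t + 1) (by linarith) ε hε
    exact ⟨N, fun n hn m hm => hN n hn m hm t ⟨ht, by linarith⟩⟩
  choose! T₀ hT₀ using fun t (ht : 0 ≤ t) f => cauchySeq_tendsto_of_complete (hcau t ht f)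
  have hT₀v : ∀ t, 0 ≤ t → ∀ f, ‖T₀ t f‖ ≤ ‖f‖ := fun t ht f =>
    le_of_tendsto (hT₀ t ht f).norm (Eventually.of_forall fun n => hSv n t ht f)
  let T : ℝ → H →L[ℝ] H := fun t => if ht : 0 ≤ t then
    LinearMap.mkContinuous
      { toFun := T₀ t
        map_add' := fun f g => tendsto_nhds_unique (hT₀ t ht (f + g)) (by
          simpa only [map_add] using (hT₀ t ht f).add (hT₀ t ht g))
        map_smul' := fun c f => tendsto_nhds_unique (hT₀ t ht (c • f)) (by
          simpa only [map_smul, RingHom.id_apply] using (hT₀ t ht f).const_smul c) } 1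
      (fun f => (hT₀v t ht f).trans_eq (one_mul _).symm) else 0
  have hT : ∀ t, 0 ≤ t → ∀ f, Tendsto (fun n => S n t f) atTop (𝓝 (T t f)) := by
    intro t ht f
    simp only [T, dif_pos ht]
    exact hT₀ t ht f
  have hTv : ∀ t, 0 ≤ t → ∀ f, ‖T t f‖ ≤ ‖f‖ := fun t ht f =>
    le_of_tendsto (hT t ht f).norm (Eventually.of_forall fun n => hSv n t ht f)
  -- moving arguments
  have hmove : ∀ t, 0 ≤ t → ∀ (v : ℕ → H) (f : H), Tendsto v atTop (𝓝 f) →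
      Tendsto (fun n => S n t (v n)) atTop (𝓝 (T t f)) := by
    intro t ht v f hv
    have h1 : Tendsto (fun n => S n t (v n - f)) atTop (𝓝 0) := by
      refine squeeze_zero_norm (fun n => hSv n t ht _) ?_
      simpa using (hv.sub_const f).norm
    simpa using (hT t ht f).add h1
  have hScont : ∀ n f, Continuous fun t => S n t f := fun n f =>
    continuous_iff_continuousAt.2 fun t => (hasDerivAt_opExp (A n) f t).continuousAt
  have hTcont : ∀ f, ContinuousOn (fun t => T t f) (Set.Ici 0) := by
    intro f t ht
    have hu : TendstoUniformlyOn (fun n t => S n t f) (fun t => T t f) atTop (Set.Icc 0 (t + 1)) := by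
      refine UniformCauchySeqOn.tendstoUniformlyOn_of_tendsto ?_ fun s hs => hT s hs.1 f
      refine Metric.uniformCauchySeqOn_iff.2 fun ε hε => ?_
      exact hUC f (t + 1) (by linarith [show (0 : ℝ) ≤ t from ht]) ε hε
    have hc : ContinuousOn (fun t => T t f) (Set.Icc 0 (t + 1)) :=
      hu.continuousOn (Frequently.of_forall fun n => (hScont n f).continuousOn)
    refine (hc t ⟨ht, by linarith⟩).mono_of_mem_nhdsWithin ?_
    rw [show Set.Icc (0 : ℝ) (t + 1) = Set.Ici 0 ∩ Set.Iic (t + 1) from rfl]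
    exact inter_mem_nhdsWithin _ (Iic_mem_nhds (by linarith))
  refine ⟨T, ⟨?_, ?_, ?_, hTcont⟩, ?_⟩
  · ext f
    refine tendsto_nhds_unique (hT 0 le_rfl f) ?_
    simp [hS, NormedSpace.exp_zero]
  · intro s t hs ht
    ext f
    refine tendsto_nhds_unique (hT (s + t) (add_nonneg hs ht) f) ?_
    have := hmove s hs _ _ (hT t ht f)
    refine this.congr fun n => ?_
    simp only [hS, add_smul]
    rw [opExp_add (((Commute.refl (A n)).smul_left s).smul_right t)]; rfl
  · intro t ht
    exact ContinuousLinearMap.opNorm_le_bound _ zero_le_one fun f => by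
      simpa using hTv t ht f
  · intro α hα h
    set v : ℕ → H := fun n => α • G α h - A n (G α h) with hv
    have hvlim : Tendsto v atTop (𝓝 h) := by
      simpa using (hAGlim α hα h).const_sub (α • G α h)
    obtain ⟨M, hM⟩ := hvlim.norm.bddAbove_range
    have hMv : ∀ n, ‖v n‖ ≤ M := fun n => hM ⟨n, rfl⟩
    have hexp : IntegrableOn (fun t : ℝ => Real.exp (-α * t) * M) (Set.Ioi 0) :=
      (integrableOn_exp_mul_Ioi (neg_neg_of_pos hα) 0).mul_const M
    have hmeas : ∀ n, AEStronglyMeasurable (fun t : ℝ => Real.exp (-α * t) • S n t (v n))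
        (volume.restrict (Set.Ioi 0)) := fun n =>
      ((by fun_prop : Continuous fun t : ℝ => Real.exp (-α * t)).smul
        (hScont n (v n))).aestronglyMeasurable
    have hbound : ∀ n, ∀ᵐ t : ℝ ∂volume.restrict (Set.Ioi 0),
        ‖Real.exp (-α * t) • S n t (v n)‖ ≤ Real.exp (-α * t) * M := fun n =>
      (ae_restrict_iff' measurableSet_Ioi).2 <| Eventually.of_forall fun t ht => by
        rw [norm_smul, Real.norm_of_nonneg (Real.exp_pos _).le]
        gcongr
        exact (hSv n t (le_of_lt ht) _).trans (hMv n)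
    have hint : ∀ n, ∫ t in Set.Ioi (0 : ℝ), Real.exp (-α * t) • S n t (v n) = G α h := by
      intro n
      have hd : ∀ t ∈ Set.Ici (0 : ℝ), HasDerivAt
          (fun t : ℝ => -(Real.exp (-α * t) • S n t (G α h)))
          (Real.exp (-α * t) • S n t (v n)) t := by
        intro t _
        have he : HasDerivAt (fun t : ℝ => Real.exp (-α * t)) (Real.exp (-α * t) * (-α)) t := by
          simpa using ((hasDerivAt_id t).const_mul (-α)).exp
        have := (he.smul (hasDerivAt_opExp (A n) (G α h) t)).neg
        refine this.congr_deriv ?_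
        simp only [hv, hS, map_sub, map_smul, smul_sub, smul_smul, neg_add, mul_neg, neg_smul,
          neg_neg]
        abel
      have ht : Tendsto (fun t : ℝ => -(Real.exp (-α * t) • S n t (G α h))) atTop (𝓝 0) := by
        have h0 : Tendsto (fun t : ℝ => Real.exp (-α * t) * ‖G α h‖) atTop (𝓝 0) := by
          have : Tendsto (fun t : ℝ => Real.exp (-α * t)) atTop (𝓝 0) :=
            Real.tendsto_exp_atBot.comp (tendsto_id.const_mul_atTop_of_neg (neg_neg_of_pos hα))
          simpa using this.mul_const ‖G α h‖
        refine squeeze_zero_norm' ?_ h0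
        filter_upwards [eventually_ge_atTop 0] with t ht
        rw [norm_neg, norm_smul, Real.norm_of_nonneg (Real.exp_pos _).le]
        gcongr
        exact hSv n t ht _
      have := integral_Ioi_of_hasDerivAt_of_tendsto' hd (hexp.mono' (hmeas n) (hbound n)) ht
      rw [this]
      simp [hS, NormedSpace.exp_zero]
    have hdom := tendsto_integral_of_dominated_convergence (μ := volume.restrict (Set.Ioi (0 : ℝ)))
      (F := fun n t => Real.exp (-α * t) • S n t (v n))
      (f := fun t => Real.exp (-α * t) • T t h) _ hmeas hexp hbound
      ((ae_restrict_iff' measurableSet_Ioi).2 <| Eventually.of_forall fun t ht =>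
        (hmove t (le_of_lt ht) v h hvlim).const_smul _)
    simp only [hint] at hdom
    exact tendsto_nhds_unique tendsto_const_nhds hdom

end HilleYosida

section Forms
variable {H : Type*} [NormedAddCommGroup H] [InnerProductSpace ℝ H]

/-- The shifted form `a_α(f, g) = a(f, g) + α (f, g)` of a bilinear form `a` on a subspace `F`. -/
noncomputable def shiftedForm {F : Submodule ℝ H} (a : F →ₗ[ℝ] F →ₗ[ℝ] ℝ) (α : ℝ) (f g : F) : ℝ :=
  a f g + α * inner ℝ (f : H) (g : H)

/-- A coercive closed form on a real Hilbert space `H`: a bilinear form on a dense subspace, which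
is non-negative definite, satisfies the weak sector condition, and whose domain is complete for the
norm `a_1(f, f)^{1/2}` of the symmetric part of `a_1` (a bilinear form and its symmetric part agree
on the diagonal). -/
structure CoerciveClosedForm (H : Type*) [NormedAddCommGroup H] [InnerProductSpace ℝ H] where
  domain : Submodule ℝ H
  dense_domain : Dense (domain : Set H)
  form : domain →ₗ[ℝ] domain →ₗ[ℝ] ℝ
  nonneg : ∀ f, 0 ≤ form f f
  sector : ∃ C : ℝ, 1 ≤ C ∧ ∀ f g, |shiftedForm form 1 f g| ≤
    C * √(shiftedForm form 1 f f) * √(shiftedForm form 1 g g)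
  complete : ∀ u : ℕ → domain,
    (∀ ε > 0, ∃ N, ∀ m ≥ N, ∀ n ≥ N, √(shiftedForm form 1 (u m - u n) (u m - u n)) < ε) →
    ∃ f, Tendsto (fun n => √(shiftedForm form 1 (u n - f) (u n - f))) atTop (𝓝 0)

/-- Lax--Milgram for a vector space whose inner product is the bilinear form `s`. -/
theorem exists_solution_of_coercive {V : Type*} [AddCommGroup V] [Module ℝ V]
    (s B : V →ₗ[ℝ] V →ₗ[ℝ] ℝ) (l : V →ₗ[ℝ] ℝ) (hsymm : ∀ f g, s f g = s g f)
    (hnonneg : ∀ f, 0 ≤ s f f) (hdef : ∀ f, s f f = 0 → f = 0)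
    (hcomplete : ∀ u : ℕ → V, (∀ ε > 0, ∃ N, ∀ m ≥ N, ∀ n ≥ N, √(s (u m - u n) (u m - u n)) < ε) →
      ∃ f, Tendsto (fun n => √(s (u n - f) (u n - f))) atTop (𝓝 0))
    (C c K : ℝ) (hc : 0 < c) (hB : ∀ f g, |B f g| ≤ C * √(s f f) * √(s g g))
    (hcoer : ∀ f, c * s f f ≤ B f f) (hl : ∀ g, |l g| ≤ K * √(s g g)) :
    ∃ u, ∀ g, B u g = l g := by
  let core : InnerProductSpace.Core ℝ V :=
    { inner := fun f g => s f g
      conj_inner_symm := fun f g => by simpa using hsymm g f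
      re_inner_nonneg := fun f => by simpa using hnonneg f
      add_left := fun f g h => by simp
      smul_left := fun f g r => by simp
      definite := fun f hf => hdef f hf }
  let _ : NormedAddCommGroup V := core.toNormedAddCommGroup
  let _ : InnerProductSpace ℝ V := InnerProductSpace.ofCore core.toCore
  have hinner : ∀ f g : V, inner ℝ f g = s f g := fun f g => rfl
  have hnorm : ∀ f : V, ‖f‖ = √(s f f) := fun f => by
    rw [← hinner, norm_eq_sqrt_real_inner]
  have : CompleteSpace V := by
    refine Metric.complete_of_cauchySeq_tendsto fun u hu => ?_
    obtain ⟨f, hf⟩ := hcomplete u fun ε hε => by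
      obtain ⟨N, hN⟩ := Metric.cauchySeq_iff.1 hu ε hε
      exact ⟨N, fun m hm n hn => by rw [← hnorm, ← dist_eq_norm]; exact hN m hm n hn⟩
    refine ⟨f, tendsto_iff_norm_sub_tendsto_zero.2 ?_⟩
    simpa only [hnorm] using hf
  let B' : V →L[ℝ] V →L[ℝ] ℝ := B.mkContinuous₂ C fun f g => by
    rw [hnorm, hnorm]; exact hB f g
  have hB' : IsCoercive B' := ⟨c, hc, fun f => by
    rw [mul_assoc, hnorm, Real.mul_self_sqrt (hnonneg f)]; exact hcoer f⟩
  let l' : V →L[ℝ] ℝ := l.mkContinuous K fun g => by rw [hnorm]; exact hl g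
  refine ⟨hB'.continuousLinearEquivOfBilin.symm ((InnerProductSpace.toDual ℝ V).symm l'),
    fun g => ?_⟩
  have h := hB'.continuousLinearEquivOfBilin_apply
    (hB'.continuousLinearEquivOfBilin.symm ((InnerProductSpace.toDual ℝ V).symm l')) g
  rw [ContinuousLinearEquiv.apply_symm_apply, InnerProductSpace.toDual_symm_apply] at h
  exact h.symm

namespace CoerciveClosedForm
variable (E : CoerciveClosedForm H)

theorem shifted_self (α : ℝ) (f : E.domain) :
    shiftedForm E.form α f f = E.form f f + α * ‖(f : H)‖ ^ 2 := by
  rw [shiftedForm, real_inner_self_eq_norm_sq]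

theorem norm_le_sqrt (f : E.domain) : ‖(f : H)‖ ≤ √(shiftedForm E.form 1 f f) := by
  refine Real.le_sqrt_of_sq_le ?_
  rw [shifted_self]; linarith [E.nonneg f]

theorem exists_resolvent (α : ℝ) (hα : 0 < α) (f : H) :
    ∃ u : E.domain, ∀ g : E.domain, shiftedForm E.form α u g = inner ℝ f (g : H) := by
  obtain ⟨C, hC1, hC⟩ := E.sector
  let ip : E.domain →ₗ[ℝ] E.domain →ₗ[ℝ] ℝ :=
    (innerₗ H).domRestrict₁₂ E.domain E.domain
  let e : E.domain →ₗ[ℝ] E.domain →ₗ[ℝ] ℝ := E.form + ip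
  have hself : ∀ f : E.domain, ((1 / 2 : ℝ) • (e + e.flip)) f f = shiftedForm E.form 1 f f := by
    intro f
    simp only [e, ip, shiftedForm, LinearMap.smul_apply, LinearMap.add_apply,
      LinearMap.flip_apply, LinearMap.domRestrict₁₂_apply, innerₗ_apply_apply, smul_eq_mul]
    ring
  have hn : ∀ f : E.domain, 0 ≤ shiftedForm E.form 1 f f := fun f => by
    rw [shifted_self]; nlinarith [E.nonneg f, sq_nonneg ‖(f : H)‖]
  have hip : ∀ f g : E.domain, |inner ℝ (f : H) (g : H)| ≤
      √(shiftedForm E.form 1 f f) * √(shiftedForm E.form 1 g g) := fun f g =>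
    (abs_real_inner_le_norm _ _).trans
      (mul_le_mul (E.norm_le_sqrt f) (E.norm_le_sqrt g) (norm_nonneg _) (Real.sqrt_nonneg _))
  obtain ⟨u, hu⟩ := exists_solution_of_coercive ((1 / 2 : ℝ) • (e + e.flip)) (E.form + α • ip)
    ((innerₗ H f).domRestrict E.domain) (fun f g => by simp [add_comm])
    (fun f => by rw [hself]; exact hn f)
    (fun f hf => by
      rw [hself, shifted_self] at hf
      have : ‖(f : H)‖ ^ 2 = 0 := by nlinarith [E.nonneg f, sq_nonneg ‖(f : H)‖]
      simpa using this)
    (fun u hu => by simp only [hself] at hu ⊢; exact E.complete u hu)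
    (C + |α - 1|) (min 1 α) ‖f‖ (lt_min one_pos hα)
    (fun f g => by
      rw [hself, hself]
      have h1 : (E.form + α • ip) f g =
          shiftedForm E.form 1 f g + (α - 1) * inner ℝ (f : H) (g : H) := by
        simp only [ip, shiftedForm, LinearMap.smul_apply, LinearMap.add_apply,
          LinearMap.domRestrict₁₂_apply, innerₗ_apply_apply, smul_eq_mul]
        ring
      rw [h1]
      calc _ ≤ |shiftedForm E.form 1 f g| + |(α - 1) * inner ℝ (f : H) (g : H)| := abs_add_le _ _
        _ ≤ C * √(shiftedForm E.form 1 f f) * √(shiftedForm E.form 1 g g) + |α - 1| *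
            (√(shiftedForm E.form 1 f f) * √(shiftedForm E.form 1 g g)) := by
          rw [abs_mul]
          exact add_le_add (hC f g) (mul_le_mul_of_nonneg_left (hip f g) (abs_nonneg _))
        _ = _ := by ring)
    (fun f => by
      rw [hself, shifted_self]
      have h1 : (E.form + α • ip) f f = E.form f f + α * ‖(f : H)‖ ^ 2 := by
        simp only [ip, LinearMap.smul_apply, LinearMap.add_apply,
          LinearMap.domRestrict₁₂_apply, innerₗ_apply_apply, smul_eq_mul,
          real_inner_self_eq_norm_sq]
      rw [h1]
      have h2 := mul_le_mul_of_nonneg_right (min_le_left 1 α) (E.nonneg f)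
      have h3 := mul_le_mul_of_nonneg_right (min_le_right 1 α) (sq_nonneg ‖(f : H)‖)
      linarith)
    (fun g => by
      rw [hself]
      exact (abs_real_inner_le_norm _ _).trans
        (mul_le_mul_of_nonneg_left (E.norm_le_sqrt g) (norm_nonneg _)))
  exact ⟨u, fun g => hu g⟩

theorem shifted_unique (α : ℝ) (hα : 0 < α) (u v : E.domain)
    (h : ∀ g, shiftedForm E.form α u g = shiftedForm E.form α v g) : u = v := by
  have h1 := h (u - v)
  have h2 : shiftedForm E.form α (u - v) (u - v) = 0 := by
    rw [← sub_eq_zero] at h1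
    rw [← h1]
    simp only [shiftedForm, map_sub, LinearMap.sub_apply, Submodule.coe_sub, inner_sub_left]
    ring
  rw [shifted_self] at h2
  have h3 : ‖((u - v : E.domain) : H)‖ ^ 2 = 0 := by
    nlinarith [E.nonneg (u - v), mul_nonneg hα.le (sq_nonneg ‖((u - v : E.domain) : H)‖)]
  exact Subtype.ext (by simpa [sub_eq_zero] using h3)

theorem exists_resolventOp (α : ℝ) (hα : 0 < α) :
    ∃ G : H →L[ℝ] H, ∀ f : H, ∃ hf : G f ∈ E.domain,
      ∀ g : E.domain, shiftedForm E.form α ⟨G f, hf⟩ g = inner ℝ f (g : H) := by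
  choose u hu using E.exists_resolvent α hα
  have hbd : ∀ f, α * ‖(u f : H)‖ ≤ ‖f‖ := by
    intro f
    have h1 := hu f (u f)
    rw [shifted_self] at h1
    have h2 : α * ‖(u f : H)‖ ^ 2 ≤ ‖f‖ * ‖(u f : H)‖ := by
      linarith [E.nonneg (u f), real_inner_le_norm f (u f : H)]
    rcases (norm_nonneg (u f : H)).eq_or_lt with h0 | h0
    · rw [← h0]; simp
    · exact le_of_mul_le_mul_right (by linarith) h0
  let G₀ : H →ₗ[ℝ] H :=
    { toFun := fun f => u f
      map_add' := fun f g => by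
        rw [← Submodule.coe_add]
        congr 1
        refine E.shifted_unique α hα _ _ fun h => ?_
        have h1 := hu f h
        have h2 := hu g h
        rw [hu, inner_add_left, ← h1, ← h2]
        simp only [shiftedForm, map_add, LinearMap.add_apply, Submodule.coe_add, inner_add_left]
        ring
      map_smul' := fun c f => by
        rw [RingHom.id_apply, ← Submodule.coe_smul]
        congr 1
        refine E.shifted_unique α hα _ _ fun h => ?_
        have h1 := hu f h
        rw [hu, real_inner_smul_left, ← h1]
        simp only [shiftedForm, map_smul, LinearMap.smul_apply, Submodule.coe_smul,
          real_inner_smul_left, smul_eq_mul]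
        ring }
  refine ⟨G₀.mkContinuous α⁻¹ fun f => ?_, fun f => ⟨(u f).2, fun g => hu f g⟩⟩
  have := hbd f
  rw [← div_eq_inv_mul, le_div_iff₀ hα]
  change ‖(u f : H)‖ * α ≤ ‖f‖
  linarith

open Classical in
/-- The resolvent `G_α`, `α > 0`: `G_α f ∈ F` and `E_α(G_α f, g) = (f, g)` for all `g ∈ F`. -/
noncomputable def resolvent (α : ℝ) : H →L[ℝ] H :=
  if hα : 0 < α then Classical.choose (E.exists_resolventOp α hα) else 0

theorem resolvent_spec {α : ℝ} (hα : 0 < α) (f : H) : ∃ hf : E.resolvent α f ∈ E.domain,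
    ∀ g : E.domain, shiftedForm E.form α ⟨E.resolvent α f, hf⟩ g = inner ℝ f (g : H) := by
  rw [resolvent, dif_pos hα]
  exact Classical.choose_spec (E.exists_resolventOp α hα) f

theorem resolvent_norm_le {α : ℝ} (hα : 0 < α) (f : H) : ‖α • E.resolvent α f‖ ≤ ‖f‖ := by
  obtain ⟨hf, h⟩ := E.resolvent_spec hα f
  have h1 := h ⟨_, hf⟩
  rw [shifted_self] at h1
  simp only at h1
  rw [norm_smul, Real.norm_of_nonneg hα.le]
  have h2 : α * ‖E.resolvent α f‖ ^ 2 ≤ ‖f‖ * ‖E.resolvent α f‖ := by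
    linarith [E.nonneg ⟨_, hf⟩, real_inner_le_norm f (E.resolvent α f)]
  rcases (norm_nonneg (E.resolvent α f)).eq_or_lt with h0 | h0
  · rw [← h0]; simp
  · exact le_of_mul_le_mul_right (by linarith) h0

theorem resolvent_sub {α β : ℝ} (hα : 0 < α) (hβ : 0 < β) (f : H) :
    E.resolvent α f - E.resolvent β f = (β - α) • E.resolvent α (E.resolvent β f) := by
  obtain ⟨h1, h1'⟩ := E.resolvent_spec hα f
  obtain ⟨h2, h2'⟩ := E.resolvent_spec hβ f
  obtain ⟨h3, h3'⟩ := E.resolvent_spec hα (E.resolvent β f)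
  have : (⟨_, h1⟩ - (β - α) • ⟨_, h3⟩ : E.domain) = ⟨_, h2⟩ := by
    refine E.shifted_unique α hα _ _ fun g => ?_
    have e1 := h1' g
    have e2 := h2' g
    have e3 := h3' g
    simp only [shiftedForm, map_sub, map_smul, LinearMap.sub_apply, LinearMap.smul_apply,
      Submodule.coe_sub, Submodule.coe_smul, inner_sub_left, real_inner_smul_left,
      smul_eq_mul] at e1 e2 e3 ⊢
    linear_combination e1 - e2 - (β - α) * e3
  have h4 := congrArg (Subtype.val) this
  simp only [Submodule.coe_sub, Submodule.coe_smul] at h4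
  exact sub_eq_iff_eq_add'.2 (sub_eq_iff_eq_add.1 h4)

theorem tendsto_smul_resolvent (f : H) :
    Tendsto (fun α : ℝ => α • E.resolvent α f) atTop (𝓝 f) := by
  obtain ⟨C, hC1, hC⟩ := E.sector
  have hdom : ∀ f : E.domain, Tendsto (fun α : ℝ => α • E.resolvent α (f : H)) atTop (𝓝 (f : H)) := by
    intro f
    set K : ℝ := (C + 1) * √(shiftedForm E.form 1 f f) with hK
    have key : ∀ α : ℝ, 1 ≤ α → ‖α • E.resolvent α (f : H) - f‖ ^ 2 ≤ K ^ 2 / α := by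
      intro α hα
      have hα0 : 0 < α := by linarith
      obtain ⟨h1, h1'⟩ := E.resolvent_spec hα0 (f : H)
      set d : E.domain := α • ⟨_, h1⟩ - f with hd
      have hdval : (d : H) = α • E.resolvent α (f : H) - f := rfl
      rw [← hdval]
      have e1 : shiftedForm E.form α d d = - E.form f d := by
        have := h1' d
        have h5 : shiftedForm E.form α d d = α * shiftedForm E.form α ⟨_, h1⟩ d
            - shiftedForm E.form α f d := by
          conv_lhs => rw [shiftedForm]
          conv_lhs => enter [1, 1]; rw [hd]
          conv_lhs => enter [2, 2, 2]; rw [hdval]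
          simp only [shiftedForm, map_sub, map_smul, LinearMap.sub_apply, LinearMap.smul_apply,
            inner_sub_left, real_inner_smul_left, smul_eq_mul]
          ring
        rw [h5, this, shiftedForm]; ring
      have hs : 0 ≤ shiftedForm E.form 1 d d := by
        rw [shifted_self]; nlinarith [E.nonneg d, sq_nonneg ‖(d : H)‖]
      have e2 : |E.form f d| ≤ K * √(shiftedForm E.form 1 d d) := by
        have h6 : E.form f d = shiftedForm E.form 1 f d - inner ℝ (f : H) (d : H) := by
          rw [shiftedForm]; ring
        have h7 : |inner ℝ (f : H) (d : H)| ≤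
            √(shiftedForm E.form 1 f f) * √(shiftedForm E.form 1 d d) :=
          (abs_real_inner_le_norm _ _).trans
            (mul_le_mul (E.norm_le_sqrt f) (E.norm_le_sqrt d) (norm_nonneg _) (Real.sqrt_nonneg _))
        rw [h6, hK]
        calc _ ≤ |shiftedForm E.form 1 f d| + |inner ℝ (f : H) (d : H)| := abs_sub _ _
          _ ≤ _ := by nlinarith [hC f d]
      set r := √(shiftedForm E.form 1 d d) with hr
      have hr0 : 0 ≤ r := Real.sqrt_nonneg _
      have hr2 : r ^ 2 = E.form d d + ‖(d : H)‖ ^ 2 := by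
        rw [hr, Real.sq_sqrt hs, shifted_self, one_mul]
      have hK0 : 0 ≤ K := by positivity
      rw [shifted_self] at e1
      have h8 : E.form d d + α * ‖(d : H)‖ ^ 2 ≤ K * r := by
        rw [e1]; exact (neg_le_abs _).trans e2
      have h9 : r ^ 2 ≤ K * r := by nlinarith [sq_nonneg ‖(d : H)‖]
      have h10 : r ≤ K := by
        rcases hr0.eq_or_lt with h0 | h0
        · rw [← h0]; exact hK0
        · nlinarith
      rw [le_div_iff₀ hα0]
      nlinarith [E.nonneg d]
    rw [tendsto_iff_norm_sub_tendsto_zero]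
    have h0 : Tendsto (fun α : ℝ => √(K ^ 2 / α)) atTop (𝓝 0) := by
      have := (Real.continuous_sqrt.tendsto 0).comp
        ((tendsto_const_nhds (x := K ^ 2)).div_atTop tendsto_id)
      simpa [Function.comp_def] using this
    refine squeeze_zero' (Eventually.of_forall fun _ => norm_nonneg _) ?_ h0
    filter_upwards [eventually_ge_atTop 1] with α hα
    exact Real.le_sqrt_of_sq_le (key α hα)
  rw [Metric.tendsto_atTop]
  intro ε hε
  obtain ⟨g, hg, hgf⟩ := Metric.mem_closure_iff.1 (E.dense_domain f) (ε / 3) (by positivity)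
  obtain ⟨N, hN⟩ := Metric.tendsto_atTop.1 (hdom ⟨g, hg⟩) (ε / 3) (by positivity)
  refine ⟨max N 1, fun α hα => ?_⟩
  have hα0 : 0 < α := lt_of_lt_of_le one_pos ((le_max_right _ _).trans hα)
  have h1 := hN α ((le_max_left _ _).trans hα)
  have h2 := E.resolvent_norm_le hα0 (f - g)
  rw [dist_eq_norm] at h1 hgf ⊢
  have h3 : α • E.resolvent α f - f =
      α • E.resolvent α (f - g) + (α • E.resolvent α g - g) - (f - g) := by
    rw [map_sub, smul_sub]; abel
  rw [h3]
  calc _ ≤ ‖α • E.resolvent α (f - g)‖ + ‖α • E.resolvent α g - g‖ + ‖f - g‖ :=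
        (norm_sub_le _ _).trans (by gcongr; exact norm_add_le _ _)
    _ < ε := by simp only at h1; linarith

theorem exists_semigroup [CompleteSpace H] : ∃ T : ℝ → H →L[ℝ] H, IsContractionSemigroup T ∧
    ∀ α : ℝ, 0 < α → ∀ f,
      E.resolvent α f = ∫ t in Set.Ioi 0, Real.exp (-α * t) • T t f :=
  exists_contractionSemigroup E.resolvent (fun _ _ hα hβ f => E.resolvent_sub hα hβ f)
    (fun _ hα f => E.resolvent_norm_le hα f) E.tendsto_smul_resolvent

/-- The semigroup `(T_t)_{t ≥ 0}` associated with the form: the strongly continuous contraction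
semigroup with `G_α f = ∫_0^∞ e^{-α t} T_t f dt` for all `α > 0` (unique by injectivity of the
Laplace transform; the values at `t < 0` play no role). -/
noncomputable def semigroup [CompleteSpace H] : ℝ → H →L[ℝ] H :=
  Classical.choose E.exists_semigroup

theorem semigroup_spec [CompleteSpace H] : IsContractionSemigroup E.semigroup ∧
    ∀ α : ℝ, 0 < α → ∀ f,
      E.resolvent α f = ∫ t in Set.Ioi 0, Real.exp (-α * t) • E.semigroup t f :=
  Classical.choose_spec E.exists_semigroup

/-- The norm `a_1(f, f)^{1/2}` on the domain. -/
noncomputable def domNorm (f : E.domain) : ℝ := √(shiftedForm E.form 1 f f)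

/-- `domNorm` as an extended functional on `H`, equal to `∞` outside the domain. -/
noncomputable def energyNorm (f : H) : ℝ≥0∞ :=
  ⨅ hf : f ∈ E.domain, ENNReal.ofReal (E.domNorm ⟨f, hf⟩)

/-- The functional `Φ(f) = sup {a_1(g, f) : g ∈ F, a_1(g, g)^{1/2} = 1}` for `f ∈ F`, extended by
`∞` outside the domain `F`. The supremum is over a set symmetric under `g ↦ -g`, so that negative
values may be truncated. -/
noncomputable def dualNorm (f : H) : ℝ≥0∞ :=
  ⨅ hf : f ∈ E.domain, ⨆ (g : E.domain) (_ : E.domNorm g = 1),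
    ENNReal.ofReal (shiftedForm E.form 1 g ⟨f, hf⟩)

end CoerciveClosedForm
end Forms

section Spaces

/-- A pointed metric measure space: a complete separable geodesic metric space with a non-zero
Borel measure which is finite on bounded sets and has full support, and a base point. -/
structure PMMSpace where
  carrier : Type*
  [metricSpace : MetricSpace carrier]
  [completeSpace : CompleteSpace carrier]
  [separableSpace : TopologicalSpace.SeparableSpace carrier]
  [measurableSpace : MeasurableSpace carrier]
  [borelSpace : BorelSpace carrier]
  geodesic : ∀ x y : carrier, ∃ γ : ℝ → carrier, γ 0 = x ∧ γ 1 = y ∧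
    ∀ s ∈ Set.Icc (0 : ℝ) 1, ∀ t ∈ Set.Icc (0 : ℝ) 1, dist (γ s) (γ t) = |s - t| * dist x y
  measure : Measure carrier
  measure_ne_zero : measure ≠ 0
  measure_lt_top : ∀ s : Set carrier, Bornology.IsBounded s → measure s < ∞
  full_support : ∀ x : carrier, ∀ r > 0, 0 < measure (Metric.ball x r)
  base : carrier

instance : CoeSort PMMSpace (Type _) := ⟨PMMSpace.carrier⟩

attribute [instance] PMMSpace.metricSpace PMMSpace.completeSpace PMMSpace.separableSpace
  PMMSpace.measurableSpace PMMSpace.borelSpace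

/-- The real Hilbert space `L²(X, m)`. -/
abbrev PMMSpace.L2 (X : PMMSpace) : Type _ := Lp ℝ 2 X.measure

variable {Z : Type*} [MetricSpace Z]

/-- `φ ∈ C_bs(Z)`: bounded continuous functions with bounded support. -/
def IsCbs (φ : Z → ℝ) : Prop :=
  Continuous φ ∧ (∃ C, ∀ z, |φ z| ≤ C) ∧ Bornology.IsBounded (Function.support φ)

/-- Isometric embeddings `ι_n : X_n → Z`, `n ∈ ℕ ∪ {∞}`, realizing the pointed measured Gromov
convergence `X_n → X_∞`: the images of the base points converge, and the integrals of every
`φ ∈ C_bs(Z)` with respect to the push-forwards of the measures under `ι_n` converge. -/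
structure RealizesPmG (X : ℕ∞ → PMMSpace) (ι : ∀ n, X n → Z) : Prop where
  isometry : ∀ n, Isometry (ι n)
  tendsto_base : Tendsto (fun n : ℕ => ι n (X n).base) atTop (𝓝 (ι ⊤ (X ⊤).base))
  tendsto_integral : ∀ φ : Z → ℝ, IsCbs φ →
    Tendsto (fun n : ℕ => ∫ x, φ (ι n x) ∂(X n).measure) atTop
      (𝓝 (∫ x, φ (ι ⊤ x) ∂(X ⊤).measure))

section Convergence
variable {Y : ℕ → PMMSpace} {YL : PMMSpace}

/-- Weak convergence of `f_k ∈ L²(Y_k)` to `f_∞ ∈ L²(Y_∞)`, where all spaces are embedded in `Z`. -/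
def WeakL2 (j : ∀ k, Y k → Z) (jL : YL → Z) (f : ∀ k, (Y k).L2) (fL : YL.L2) : Prop :=
  (∃ C, ∀ k, ‖f k‖ ≤ C) ∧
  ∀ φ : Z → ℝ, IsCbs φ →
    Tendsto (fun k => ∫ x, φ (j k x) * f k x ∂(Y k).measure) atTop
      (𝓝 (∫ x, φ (jL x) * fL x ∂YL.measure))

/-- Strong convergence of `f_k ∈ L²(Y_k)` to `f_∞ ∈ L²(Y_∞)`. -/
def StrongL2 (j : ∀ k, Y k → Z) (jL : YL → Z) (f : ∀ k, (Y k).L2) (fL : YL.L2) : Prop :=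
  WeakL2 j jL f fL ∧ limsup (fun k => ‖f k‖ ^ 2) atTop ≤ ‖fL‖ ^ 2

/-- Strong convergence of `f_k(t)` to `f_∞(t)` uniformly in `t ∈ S`: the norms are uniformly
bounded, and the integrals against every `φ ∈ C_bs(Z)` and the norms converge uniformly on `S`. For
`S` compact and `f_∞` continuous this is the strong convergence of `f_k(t_k)` to `f_∞(t)` whenever
`t_k → t` in `S`. -/
def StrongL2UniformlyOn (j : ∀ k, Y k → Z) (jL : YL → Z) (f : ∀ k, ℝ → (Y k).L2)
    (fL : ℝ → YL.L2) (S : Set ℝ) : Prop :=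
  (∃ C, ∀ k, ∀ t ∈ S, ‖f k t‖ ≤ C) ∧
  (∀ φ : Z → ℝ, IsCbs φ →
    TendstoUniformlyOn (fun k t => ∫ x, φ (j k x) * f k t x ∂(Y k).measure)
      (fun t => ∫ x, φ (jL x) * fL t x ∂YL.measure) atTop S) ∧
  TendstoUniformlyOn (fun k t => ‖f k t‖) (fun t => ‖fL t‖) atTop S

end Convergence

section Conditions
variable {X : ℕ∞ → PMMSpace} (ι : ∀ n, X n → Z) (E : ∀ n, CoerciveClosedForm (X n).L2)

/-- The condition (F1), with `N_n = Φ_n`, or (F1_*), with `N_n` the energy norm: weak limits of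
sequences with `liminf N_n(f_n) < ∞` lie in the domain of the limit form. -/
def CondF1 (N : ∀ n, (X n).L2 → ℝ≥0∞) : Prop :=
  ∀ (f : ∀ n : ℕ, (X n).L2) (fL : (X ⊤).L2),
    WeakL2 (fun n : ℕ => ι n) (ι ⊤) f fL →
    liminf (fun n : ℕ => N n (f n)) atTop < ∞ → fL ∈ (E ⊤).domain

/-- The condition (F2). -/
def CondF2 : Prop :=
  ∀ (f : ∀ n : ℕ, (E n).domain) (fL wL : (E ⊤).domain),
    WeakL2 (fun n : ℕ => ι n) (ι ⊤) (fun n => (f n : (X n).L2)) (fL : (X ⊤).L2) →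
    ∃ w : ∀ n : ℕ, (E n).domain,
      StrongL2 (fun n : ℕ => ι n) (ι ⊤) (fun n => (w n : (X n).L2)) (wL : (X ⊤).L2) ∧
      Tendsto (fun n : ℕ => (E n).form (w n) (f n)) atTop (𝓝 ((E ⊤).form wL fL))

/-- The condition (F2'), with `N_n = Φ_n`, or (F2'_*), with `N_n` the energy norm. As `N_n` is
infinite outside the domain, the bound on `N_{n_k}(f_k)` only admits `f_k` in the domain. -/
def CondF2Prime (N : ∀ n, (X n).L2 → ℝ≥0∞) : Prop :=
  ∀ (n : ℕ → ℕ), StrictMono n →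
  ∀ (f : ∀ k, (E (n k)).domain) (fL : (E ⊤).domain),
    WeakL2 (fun k => ι (n k)) (ι ⊤) (fun k => (f k : (X (n k)).L2)) (fL : (X ⊤).L2) →
    (⨆ k, N (n k) (f k)) < ∞ →
    ∃ C : Set (E ⊤).domain, (∀ v, ∀ ε > 0, ∃ w ∈ C, (E ⊤).domNorm (v - w) < ε) ∧
      ∀ w ∈ C, ∃ u : ∀ k, (E (n k)).domain,
        StrongL2 (fun k => ι (n k)) (ι ⊤) (fun k => (u k : (X (n k)).L2)) (w : (X ⊤).L2) ∧
        liminf (fun k => (((E (n k)).form (u k) (f k) : ℝ) : EReal)) atTop ≤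
          (((E ⊤).form w fL : ℝ) : EReal)

/-- The condition (R): strong convergence of resolvents. -/
def ResolventConv : Prop :=
  ∀ (f : ∀ n : ℕ, (X n).L2) (fL : (X ⊤).L2), StrongL2 (fun n : ℕ => ι n) (ι ⊤) f fL →
    ∀ α : ℝ, 0 < α → StrongL2 (fun n : ℕ => ι n) (ι ⊤)
      (fun n : ℕ => (E n).resolvent α (f n)) ((E ⊤).resolvent α fL)

/-- The condition (S): strong convergence of semigroups, uniformly on compact time intervals. -/
def SemigroupConv : Prop :=
  ∀ (f : ∀ n : ℕ, (X n).L2) (fL : (X ⊤).L2), StrongL2 (fun n : ℕ => ι n) (ι ⊤) f fL →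
    (∀ t : ℝ, 0 ≤ t → StrongL2 (fun n : ℕ => ι n) (ι ⊤)
      (fun n : ℕ => (E n).semigroup t (f n)) ((E ⊤).semigroup t fL)) ∧
    ∀ T : ℝ, 0 < T → StrongL2UniformlyOn (fun n : ℕ => ι n) (ι ⊤)
      (fun (n : ℕ) t => (E n).semigroup t (f n)) (fun t => (E ⊤).semigroup t fL) (Set.Icc 0 T)

end Conditions
end Spaces

/-! The test space $C_{bs}(Z)$ reduces the problem to Hilbert spaces. The maps
$\varphi\mapsto\varphi\circ\iota_n$ into $L^2(m_n)$ have converging inner products, because products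
of test functions are test functions, and the limit map has dense range. Strong convergence then
means that the distances to all test vectors converge. It is dual to weak convergence: $f_n\to f$
strongly iff $(f_n,g_n)\to(f,g)$ whenever $g_n\to g$ weakly (`StrongConv.tendsto_inner`,
`strongConv_of_tendsto_inner`). Hence (R) follows once the co-resolvents $\hat G_\alpha$, the
resolvents of the adjoint forms, preserve weak convergence.

(F1) and (F2') give (R). Let $g_n\to g$ weakly and $v_n=\hat G^n_\alpha g_n$, so that $\mathcal
E^n_\alpha(w,v_n)=(g_n,w)$. This equation bounds $\Phi_n(v_n)$ with no sector constant, so uniformly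
in $n$. A weak subsequential limit $v$ lies in the domain by (F1), and (F2') yields
$(g,w)\le\mathcal E^\infty_\alpha(w,v)$ for $w$ in a dense set. By density this holds for all $w$;
replacing $w$ by $-w$ gives equality, so $v=\hat G^\infty_\alpha g$ (`weakConv_flip_resolvent`).

(R) gives (F1). The bound $\Phi_n(f_n)\le M$, tested on $G_1k_n$, reads $(k_n,f_n)\le
M(k_n,G_1k_n)^{1/2}$. It contains only resolvents and passes to the limit. As the range of $G_1$ is
dense in the form norm, the limit inequality puts $f_\infty$ into the domain
(`mem_domain_of_inner_le`).

(R) gives (F2). For $w=G_1k$ take $w_n=G^n_1k_n$ with $k_n\to k$ strongly; then $\mathcal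
E_n(w_n,f_n)=(k_n,f_n)-(w_n,f_n)$ converges. A diagonal argument covers general $w$
(`exists_recovery_of_resolventConv`).

(R) and (S). The Laplace transform leads from (S) to (R). Conversely, exponentials of the bounded
Yosida approximations converge term by term, and on $G_1G_1g$ they differ from the semigroup by at
most $4\|g\|t/\alpha$, uniformly in $n$. Joint convergence in $n$ and $t$ gives uniformity on
compact intervals.

Part (ii) holds because the energy norm is at most $\Phi_n$, so that the starred conditions are the
stronger ones. -/

/-! ### Weak and strong convergence along varying Hilbert spaces -/

section VaryingHilbert

/-- Diagonal sequences: if `p j` holds eventually for every `j`, then `p (k n) n` holds eventually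
for some `k n → ∞`. -/
theorem exists_tendsto_atTop_eventually_diag {p : ℕ → ℕ → Prop} (h : ∀ j, ∀ᶠ n in atTop, p j n) :
    ∃ k : ℕ → ℕ, Tendsto k atTop atTop ∧ ∀ᶠ n in atTop, p (k n) n := by
  classical
  -- The index is the largest `j ≤ n` with `p j n`. The search returns `0` when there is none, so `p
  -- 0 n` is needed for its value to satisfy `p`.
  refine ⟨fun n => Nat.findGreatest (fun j => p j n) n, tendsto_atTop.2 fun j => ?_, ?_⟩
  · filter_upwards [h j, eventually_ge_atTop j] with n hn hjn
    exact Nat.le_findGreatest hjn hn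
  · filter_upwards [h 0] with n hn
    exact Nat.findGreatest_spec (P := fun j => p j n) (Nat.zero_le n) hn

/-- Strong convergence is a statement about distances, weak convergence one about pairings. This
identity and the next one translate between them. -/
theorem norm_sq_add_norm_sq_sub_div_two {F : Type*} [NormedAddCommGroup F] [InnerProductSpace ℝ F]
    (a b : F) : (‖a‖ ^ 2 + ‖b‖ ^ 2 - ‖a - b‖ ^ 2) / 2 = inner ℝ b a := by
  rw [norm_sub_sq_real, real_inner_comm]; ring

theorem sqrt_norm_sq_sub_add {F : Type*} [NormedAddCommGroup F] [InnerProductSpace ℝ F]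
    (a b : F) : √(‖a‖ ^ 2 - 2 * inner ℝ b a + ‖b‖ ^ 2) = ‖a - b‖ := by
  rw [real_inner_comm, ← norm_sub_sq_real, Real.sqrt_sq (norm_nonneg _)]

/-- The Riesz representation of a functional on a dense image. -/
theorem exists_inner_of_denseRange {V K : Type*} [AddCommGroup V] [Module ℝ V]
    [NormedAddCommGroup K] [InnerProductSpace ℝ K] [CompleteSpace K] {Q : V →ₗ[ℝ] K}
    (hQ : DenseRange Q) (L : V →ₗ[ℝ] ℝ) (C : ℝ) (hL : ∀ φ, |L φ| ≤ C * ‖Q φ‖) :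
    ∃ v, ∀ φ, inner ℝ (Q φ) v = L φ :=
  ⟨(InnerProductSpace.toDual ℝ K).symm (L.extendOfNorm Q), fun φ => by
    rw [real_inner_comm, InnerProductSpace.toDual_symm_apply]
    exact LinearMap.extendOfNorm_eq hQ ⟨C, hL⟩ φ⟩

variable {I : Type*} {V : Type*} [AddCommGroup V] [Module ℝ V]
  {H : I → Type*} [∀ i, NormedAddCommGroup (H i)] [∀ i, InnerProductSpace ℝ (H i)]
  {K : Type*} [NormedAddCommGroup K] [InnerProductSpace ℝ K]

/-- Linear maps `P_i : V → H_i` that are asymptotically isometric to `Q : V → K` of dense range: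
the data by which the Hilbert spaces `H_i` converge to `K`. -/
structure AsymptoticIsometry (l : Filter I) (P : ∀ i, V →ₗ[ℝ] H i) (Q : V →ₗ[ℝ] K) : Prop where
  denseRange : DenseRange Q
  tendsto_inner : ∀ φ ψ, Tendsto (fun i => inner ℝ (P i φ) (P i ψ)) l (𝓝 (inner ℝ (Q φ) (Q ψ)))

/-- Weak convergence of `f_i ∈ H_i` to `f ∈ K`. -/
def WeakConv (l : Filter I) (P : ∀ i, V →ₗ[ℝ] H i) (Q : V →ₗ[ℝ] K) (f : ∀ i, H i) (fL : K) :
    Prop :=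
  (∃ C, ∀ᶠ i in l, ‖f i‖ ≤ C) ∧
    ∀ φ, Tendsto (fun i => inner ℝ (P i φ) (f i)) l (𝓝 (inner ℝ (Q φ) fL))

/-- Strong convergence of `f_i ∈ H_i` to `f ∈ K`. -/
def StrongConv (l : Filter I) (P : ∀ i, V →ₗ[ℝ] H i) (Q : V →ₗ[ℝ] K) (f : ∀ i, H i) (fL : K) :
    Prop :=
  ∀ φ, Tendsto (fun i => ‖f i - P i φ‖) l (𝓝 ‖fL - Q φ‖)

variable {l : Filter I} {P : ∀ i, V →ₗ[ℝ] H i} {Q : V →ₗ[ℝ] K} {f g : ∀ i, H i} {fL gL : K}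

theorem AsymptoticIsometry.comp {J : Type*} {l' : Filter J} {n : J → I}
    (h : AsymptoticIsometry l P Q) (hn : Tendsto n l' l) :
    AsymptoticIsometry l' (fun k => P (n k)) Q :=
  ⟨h.denseRange, fun φ ψ => (h.tendsto_inner φ ψ).comp hn⟩

theorem WeakConv.comp {J : Type*} {l' : Filter J} {n : J → I}
    (h : WeakConv l P Q f fL) (hn : Tendsto n l' l) :
    WeakConv l' (fun k => P (n k)) Q (fun k => f (n k)) fL :=
  ⟨h.1.imp fun _ hC => hn.eventually hC, fun φ => (h.2 φ).comp hn⟩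

theorem StrongConv.comp {J : Type*} {l' : Filter J} {n : J → I}
    (h : StrongConv l P Q f fL) (hn : Tendsto n l' l) :
    StrongConv l' (fun k => P (n k)) Q (fun k => f (n k)) fL :=
  fun φ => (h φ).comp hn

theorem AsymptoticIsometry.tendsto_norm_sub (h : AsymptoticIsometry l P Q) (φ ψ : V) :
    Tendsto (fun i => ‖P i φ - P i ψ‖) l (𝓝 ‖Q φ - Q ψ‖) := by
  have := (Real.continuous_sqrt.tendsto _).comp (h.tendsto_inner (φ - ψ) (φ - ψ))
  simpa only [Function.comp_def, ← norm_eq_sqrt_real_inner, map_sub] using this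

theorem AsymptoticIsometry.tendsto_norm (h : AsymptoticIsometry l P Q) (φ : V) :
    Tendsto (fun i => ‖P i φ‖) l (𝓝 ‖Q φ‖) := by
  simpa using h.tendsto_norm_sub φ 0

theorem AsymptoticIsometry.strongConv (h : AsymptoticIsometry l P Q) (φ : V) :
    StrongConv l P Q (fun i => P i φ) (Q φ) :=
  fun ψ => h.tendsto_norm_sub φ ψ

theorem AsymptoticIsometry.exists_norm_sub_lt (h : AsymptoticIsometry l P Q) (v : K) {ε : ℝ}
    (hε : 0 < ε) : ∃ φ, ‖v - Q φ‖ < ε := by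
  obtain ⟨φ, hφ⟩ := h.denseRange.exists_dist_lt v hε
  exact ⟨φ, by rwa [← dist_eq_norm]⟩

theorem StrongConv.tendsto_norm (h : StrongConv l P Q f fL) :
    Tendsto (fun i => ‖f i‖) l (𝓝 ‖fL‖) := by
  simpa using h 0

theorem StrongConv.eventually_norm_le (h : StrongConv l P Q f fL) :
    ∀ᶠ i in l, ‖f i‖ ≤ ‖fL‖ + 1 :=
  (h.tendsto_norm.eventually (gt_mem_nhds (lt_add_one ‖fL‖))).mono fun _ => le_of_lt

theorem StrongConv.weakConv (h : StrongConv l P Q f fL) (hP : AsymptoticIsometry l P Q) :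
    WeakConv l P Q f fL := by
  refine ⟨⟨_, h.eventually_norm_le⟩, fun φ => ?_⟩
  have h1 := (((h.tendsto_norm.pow 2).add ((hP.tendsto_norm φ).pow 2)).sub
    ((h φ).pow 2)).div_const 2
  simpa only [norm_sq_add_norm_sq_sub_div_two] using h1

theorem WeakConv.strongConv_of_tendsto_norm (h : WeakConv l P Q f fL)
    (hP : AsymptoticIsometry l P Q) (hn : Tendsto (fun i => ‖f i‖) l (𝓝 ‖fL‖)) :
    StrongConv l P Q f fL := by
  intro φ
  have h1 := (Real.continuous_sqrt.tendsto _).comp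
    (((hn.pow 2).sub ((h.2 φ).const_mul 2)).add ((hP.tendsto_norm φ).pow 2))
  simpa only [Function.comp_def, sqrt_norm_sq_sub_add] using h1

/-- Lower semicontinuity of the norm under weak convergence. -/
theorem WeakConv.eventually_lt_norm_sq (h : WeakConv l P Q f fL) (hP : AsymptoticIsometry l P Q)
    {a : ℝ} (ha : a < ‖fL‖ ^ 2) : ∀ᶠ i in l, a < ‖f i‖ ^ 2 := by
  -- For every test vector, $\|f_i\|^2\ge 2(P_i\varphi,f_i)-\|P_i\varphi\|^2$, and the right side
  -- tends to $\|f\|^2-\|f-Q\varphi\|^2$. The chosen radius makes this limit exceed `a`.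
  obtain ⟨φ, hφ⟩ := hP.exists_norm_sub_lt fL (Real.sqrt_pos.2 (sub_pos.2 ha))
  have h1 := ((h.2 φ).const_mul 2).sub ((hP.tendsto_norm φ).pow 2)
  have h2 : a < 2 * inner ℝ (Q φ) fL - ‖Q φ‖ ^ 2 := by
    have h3 := norm_sub_sq_real fL (Q φ)
    have h4 : ‖fL - Q φ‖ ^ 2 < ‖fL‖ ^ 2 - a := (Real.lt_sqrt (norm_nonneg _)).1 hφ
    rw [real_inner_comm] at h3
    linarith
  filter_upwards [h1.eventually (lt_mem_nhds h2)] with i hi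
  have h3 := norm_sub_sq_real (f i) (P i φ)
  rw [real_inner_comm] at h3
  nlinarith [sq_nonneg ‖f i - P i φ‖]

theorem WeakConv.strongConv_of_eventually_lt (h : WeakConv l P Q f fL)
    (hP : AsymptoticIsometry l P Q) (hn : ∀ a, ‖fL‖ ^ 2 < a → ∀ᶠ i in l, ‖f i‖ ^ 2 < a) :
    StrongConv l P Q f fL := by
  refine h.strongConv_of_tendsto_norm hP ?_
  have h1 : Tendsto (fun i => ‖f i‖ ^ 2) l (𝓝 (‖fL‖ ^ 2)) :=
    tendsto_order.2 ⟨fun a ha => h.eventually_lt_norm_sq hP ha, hn⟩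
  simpa only [Function.comp_def, Real.sqrt_sq (norm_nonneg _)] using
    (Real.continuous_sqrt.tendsto _).comp h1

/-- Replacing $f_i$ by $P_i\varphi$ with $Q\varphi$ close to $f$ costs little, since
$\|f_i-P_i\varphi\|\to\|f-Q\varphi\|$ and the $g_i$ are bounded. What remains is weak convergence
tested on $\varphi$. -/
theorem StrongConv.tendsto_inner (hf : StrongConv l P Q f fL) (hg : WeakConv l P Q g gL)
    (hP : AsymptoticIsometry l P Q) :
    Tendsto (fun i => inner ℝ (f i) (g i)) l (𝓝 (inner ℝ fL gL)) := by
  obtain ⟨C, hC⟩ := hg.1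
  rw [Metric.tendsto_nhds]
  intro ε hε
  set M := |C| + ‖gL‖ + 1 with hM
  have hM0 : 0 < M := by positivity
  obtain ⟨φ, hφ⟩ := hP.exists_norm_sub_lt fL (show 0 < ε / (2 * M) by positivity)
  filter_upwards [hC, (hf φ).eventually (gt_mem_nhds hφ),
    Metric.tendsto_nhds.1 (hg.2 φ) (ε / 2) (by positivity)] with i hi h1 h2
  rw [Real.dist_eq] at h2 ⊢
  have e : inner ℝ (f i) (g i) - inner ℝ fL gL = inner ℝ (f i - P i φ) (g i)
      + (inner ℝ (P i φ) (g i) - inner ℝ (Q φ) gL) - inner ℝ (fL - Q φ) gL := by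
    rw [inner_sub_left, inner_sub_left]; ring
  have h3 : |inner ℝ (f i - P i φ) (g i)| ≤ ε / (2 * M) * |C| :=
    (abs_real_inner_le_norm _ _).trans
      (mul_le_mul h1.le (hi.trans (le_abs_self C)) (norm_nonneg _) (by positivity))
  have h4 : |inner ℝ (fL - Q φ) gL| ≤ ε / (2 * M) * ‖gL‖ :=
    (abs_real_inner_le_norm _ _).trans (mul_le_mul_of_nonneg_right hφ.le (norm_nonneg _))
  have h5 : ε / (2 * M) * |C| + ε / (2 * M) * ‖gL‖ < ε / 2 := by
    have : ε / (2 * M) * M = ε / 2 := by field_simp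
    have h6 : 0 < ε / (2 * M) := by positivity
    calc _ = ε / (2 * M) * M - ε / (2 * M) := by rw [hM]; ring
      _ < _ := by linarith
  rw [e]
  calc _ ≤ |inner ℝ (f i - P i φ) (g i)| + |inner ℝ (P i φ) (g i) - inner ℝ (Q φ) gL|
        + |inner ℝ (fL - Q φ) gL| := (abs_sub _ _).trans (by gcongr; exact abs_add_le _ _)
    _ < ε := by linarith

/-- Strongly convergent test sequences give weak convergence; the sequence paired with itself then
gives convergence of norms. In this dual form linearity and passage to adjoints become immediate. -/
theorem strongConv_of_tendsto_inner (hP : AsymptoticIsometry l P Q)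
    (hb : ∃ C, ∀ᶠ i in l, ‖f i‖ ≤ C)
    (h : ∀ (g : ∀ i, H i) (gL : K), WeakConv l P Q g gL →
      Tendsto (fun i => inner ℝ (g i) (f i)) l (𝓝 (inner ℝ gL fL))) :
    StrongConv l P Q f fL := by
  have hw : WeakConv l P Q f fL := ⟨hb, fun φ => h _ _ ((hP.strongConv φ).weakConv hP)⟩
  refine hw.strongConv_of_tendsto_norm hP ?_
  simpa only [Function.comp_def, ← norm_eq_sqrt_real_inner] using
    (Real.continuous_sqrt.tendsto _).comp (h f fL hw)

theorem StrongConv.sub (hf : StrongConv l P Q f fL) (hg : StrongConv l P Q g gL)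
    (hP : AsymptoticIsometry l P Q) :
    StrongConv l P Q (fun i => f i - g i) (fL - gL) := by
  refine strongConv_of_tendsto_inner hP ⟨‖fL‖ + 1 + (‖gL‖ + 1), ?_⟩ fun u uL hu => ?_
  · filter_upwards [hf.eventually_norm_le, hg.eventually_norm_le] with i h1 h2
    exact (norm_sub_le _ _).trans (add_le_add h1 h2)
  · simpa only [inner_sub_right, real_inner_comm] using
      (hf.tendsto_inner hu hP).sub (hg.tendsto_inner hu hP)

theorem StrongConv.const_smul (c : ℝ) (hf : StrongConv l P Q f fL)
    (hP : AsymptoticIsometry l P Q) : StrongConv l P Q (fun i => c • f i) (c • fL) := by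
  refine strongConv_of_tendsto_inner hP ⟨|c| * (‖fL‖ + 1), ?_⟩ fun u uL hu => ?_
  · filter_upwards [hf.eventually_norm_le] with i h1
    rw [norm_smul, Real.norm_eq_abs]
    gcongr
  · simpa only [inner_smul_right, real_inner_comm, RCLike.ofReal_real_eq_id, id] using
      (hf.tendsto_inner hu hP).const_mul c

/-- Strong convergence is closed under uniform approximation. -/
theorem strongConv_of_approx
    (h : ∀ ε > 0, ∃ (g : ∀ i, H i) (gL : K), StrongConv l P Q g gL ∧ ‖fL - gL‖ ≤ ε ∧
      ∀ᶠ i in l, ‖f i - g i‖ ≤ ε) : StrongConv l P Q f fL := by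
  intro φ
  rw [Metric.tendsto_nhds]
  intro ε hε
  obtain ⟨g, gL, hg, h1, h2⟩ := h (ε / 3) (by positivity)
  filter_upwards [h2, Metric.tendsto_nhds.1 (hg φ) (ε / 3) (by positivity)] with i h3 h4
  rw [Real.dist_eq] at h4 ⊢
  have h5 := abs_norm_sub_norm_le (f i - P i φ) (g i - P i φ)
  have h6 := abs_norm_sub_norm_le (fL - Q φ) (gL - Q φ)
  rw [sub_sub_sub_cancel_right] at h5 h6
  rw [abs_lt] at h4 ⊢
  rw [abs_le] at h5 h6
  constructor <;> linarith

theorem StrongConv.of_norm_sub_tendsto_zero (hf : StrongConv l P Q f fL)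
    (h : Tendsto (fun i => ‖g i - f i‖) l (𝓝 0)) : StrongConv l P Q g fL :=
  strongConv_of_approx fun ε hε => ⟨f, fL, hf, by simpa using hε.le,
    (h.eventually (gt_mem_nhds hε)).mono fun _ => le_of_lt⟩

end VaryingHilbert

/-! ### Diagonal sequences, weak compactness and extension of subsequences -/

section VaryingHilbertSeq

variable {V : Type*} [AddCommGroup V] [Module ℝ V]
  {H : ℕ → Type*} [∀ i, NormedAddCommGroup (H i)] [∀ i, InnerProductSpace ℝ (H i)]
  {K : Type*} [NormedAddCommGroup K] [InnerProductSpace ℝ K]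
  {P : ∀ i, V →ₗ[ℝ] H i} {Q : V →ₗ[ℝ] K}

/-- The sequence is $P_n\varphi_{k(n)}$ with $Q\varphi_j\to v$. The index $k(n)$ grows so slowly
that distances from $P_n\varphi_{k(n)}$ to the earlier $P_n\varphi_i$ exceed their limits by less
than $1/(k(n)+1)$. -/
theorem AsymptoticIsometry.exists_strongConv (hP : AsymptoticIsometry atTop P Q) (v : K) :
    ∃ f : ∀ n, H n, StrongConv atTop P Q f v := by
  choose φ hφ using fun j : ℕ => hP.exists_norm_sub_lt v (Nat.one_div_pos_of_nat (n := j) (α := ℝ))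
  obtain ⟨k, hk, hkn⟩ := exists_tendsto_atTop_eventually_diag
    (p := fun j n => ∀ i ∈ Finset.range (j + 1),
      ‖P n (φ j) - P n (φ i)‖ < ‖Q (φ j) - Q (φ i)‖ + 1 / ((j : ℝ) + 1)) fun j => by
      rw [eventually_all_finset]
      exact fun i _ => (hP.tendsto_norm_sub _ _).eventually
        (gt_mem_nhds (lt_add_of_pos_right _ Nat.one_div_pos_of_nat))
  refine ⟨fun n => P n (φ (k n)), strongConv_of_approx fun ε hε => ?_⟩
  -- Three errors of size at most $1/(j+1)$ add up: those of $\varphi_{k(n)}$ and $\varphi_j$, and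
  -- the diagonal slack.
  obtain ⟨j, hj⟩ := exists_nat_one_div_lt (show 0 < ε / 3 by positivity)
  refine ⟨fun n => P n (φ j), Q (φ j), hP.strongConv _, by linarith [hφ j], ?_⟩
  filter_upwards [hkn, hk.eventually_ge_atTop j] with n h1 h2
  have h3 := h1 j (Finset.mem_range.2 (by omega))
  have h4 : 1 / ((k n : ℝ) + 1) ≤ 1 / ((j : ℝ) + 1) := by gcongr
  have h5 : ‖Q (φ (k n)) - Q (φ j)‖ ≤ ‖v - Q (φ (k n))‖ + ‖v - Q (φ j)‖ := by
    rw [norm_sub_rev v (Q (φ (k n)))]; exact norm_sub_le_norm_sub_add_norm_sub _ _ _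
  linarith [hφ j, hφ (k n)]

/-- Bounded sequences have weakly convergent subsequences. -/
theorem AsymptoticIsometry.exists_weakConv_subseq [CompleteSpace K]
    [TopologicalSpace.SeparableSpace K] (hP : AsymptoticIsometry atTop P Q) {f : ∀ n, H n} {C : ℝ}
    (hf : ∀ n, ‖f n‖ ≤ C) :
    ∃ (n : ℕ → ℕ) (fL : K), StrictMono n ∧
      WeakConv atTop (fun k => P (n k)) Q (fun k => f (n k)) fL := by
  have hC : 0 ≤ C := (norm_nonneg _).trans (hf 0)
  -- Separability leaves countably many test vectors to control.
  obtain ⟨φ, hφ⟩ : ∃ φ : ℕ → V, DenseRange fun k => Q (φ k) := by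
    have : SecondCountableTopology K := UniformSpace.secondCountable_of_separable K
    have hd := TopologicalSpace.denseRange_denseSeq (Set.range Q)
    choose φ h using fun k => (TopologicalSpace.denseSeq (Set.range Q) k).2
    refine ⟨φ, ?_⟩
    have h1 : DenseRange ((↑) : Set.range Q → K) := by
      rw [DenseRange, Subtype.range_coe]; exact hP.denseRange
    have h2 := h1.comp hd continuous_subtype_val
    convert h2 using 1
    exact funext h
  have hB : ∀ j, ∃ B, ∀ n, ‖P n (φ j)‖ ≤ B := fun j => by
    obtain ⟨B, hB⟩ := (hP.tendsto_norm (φ j)).bddAbove_range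
    exact ⟨B, fun n => hB ⟨n, rfl⟩⟩
  choose B hB using hB
  -- The pairings with these vectors form a sequence in a countable product of compact intervals, so
  -- one subsequence makes all of them converge.
  have hcomp : IsCompact (Set.pi Set.univ fun j => Set.Icc (-(B j * C)) (B j * C)) :=
    isCompact_univ_pi fun j => isCompact_Icc
  obtain ⟨a, -, n, hn, ha⟩ := hcomp.tendsto_subseq
    (x := fun n j => inner ℝ (P n (φ j)) (f n)) fun n j _ => abs_le.1
      ((abs_real_inner_le_norm _ _).trans
        (mul_le_mul (hB j n) (hf n) (norm_nonneg _) ((norm_nonneg _).trans (hB j n))))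
  rw [tendsto_pi_nhds] at ha
  have hcau : ∀ ψ, CauchySeq fun k => inner ℝ (P (n k) ψ) (f (n k)) := by
    intro ψ
    rw [Metric.cauchySeq_iff']
    intro ε hε
    obtain ⟨j, hj⟩ := hφ.exists_dist_lt (Q ψ) (show 0 < ε / (4 * (C + 1)) by positivity)
    rw [dist_eq_norm] at hj
    have h1 := ((hP.tendsto_norm_sub ψ (φ j)).comp hn.tendsto_atTop).eventually (gt_mem_nhds hj)
    obtain ⟨N₂, hN₂⟩ := Metric.cauchySeq_iff.1 (ha j).cauchySeq (ε / 4) (by positivity)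
    obtain ⟨N₁, hN₁⟩ := eventually_atTop.1 h1
    have hest : ∀ k ≥ N₁, |inner ℝ (P (n k) ψ) (f (n k)) - inner ℝ (P (n k) (φ j)) (f (n k))|
        ≤ ε / 4 := by
      intro k hk
      rw [← inner_sub_left]
      calc _ ≤ ε / (4 * (C + 1)) * (C + 1) := (abs_real_inner_le_norm _ _).trans
            (mul_le_mul (hN₁ k hk).le (by linarith [hf (n k)]) (norm_nonneg _) (by positivity))
        _ = ε / 4 := by field_simp
    refine ⟨max N₁ N₂, fun k hk => ?_⟩
    have e1 := hest k ((le_max_left _ _).trans hk)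
    have e2 := hest _ (le_max_left N₁ N₂)
    have e3 := hN₂ k ((le_max_right _ _).trans hk) _ (le_max_right N₁ N₂)
    rw [Real.dist_eq] at e3 ⊢
    simp only [Function.comp_apply] at e3
    rw [abs_lt] at e3 ⊢
    rw [abs_le] at e1 e2
    constructor <;> linarith
  choose L hL using fun ψ => cauchySeq_tendsto_of_complete (hcau ψ)
  let L' : V →ₗ[ℝ] ℝ :=
    { toFun := L
      map_add' := fun ψ χ => tendsto_nhds_unique (hL _) (by
        simpa only [map_add, inner_add_left] using (hL ψ).add (hL χ))
      map_smul' := fun c ψ => tendsto_nhds_unique (hL _) (by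
        simpa only [map_smul, real_inner_smul_left, RingHom.id_apply, smul_eq_mul] using
          (hL ψ).const_mul c) }
  -- The limit of the pairings is linear and bounded by $C\|Q\psi\|$, hence represented by a vector
  -- of the limit space.
  obtain ⟨v, hv⟩ := exists_inner_of_denseRange hP.denseRange L' C fun ψ => by
    have h1 := ((hP.tendsto_norm ψ).comp hn.tendsto_atTop).const_mul C
    refine le_of_tendsto_of_tendsto (hL ψ).abs h1 (Eventually.of_forall fun k => ?_)
    refine (abs_real_inner_le_norm _ _).trans ?_
    rw [mul_comm]
    exact mul_le_mul_of_nonneg_right (hf _) (norm_nonneg _)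
  refine ⟨n, v, hn, ⟨C, Eventually.of_forall fun k => hf _⟩, fun ψ => ?_⟩
  rw [hv]
  exact hL ψ

/-- A weakly convergent subsequence extends to a weakly convergent sequence, with prescribed strongly
convergent entries off the subsequence. -/
theorem WeakConv.extend (hP : AsymptoticIsometry atTop P Q) {n : ℕ → ℕ} (hn : StrictMono n)
    {f : ∀ k, H (n k)} {h : ∀ i, H i} {fL : K}
    (hf : WeakConv atTop (fun k => P (n k)) Q f fL) (hh : StrongConv atTop P Q h fL) :
    ∃ g : ∀ i, H i, (∀ k, g (n k) = f k) ∧ (∀ i ∉ Set.range n, g i = h i) ∧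
      WeakConv atTop P Q g fL := by
  classical
  -- The entry at `n k` is transported along the equality of indices; injectivity of `n` makes the
  -- choice consistent.
  have hex : ∀ i, ∃ y : H i, (∀ k (hk : n k = i), y = hk ▸ f k) ∧ (i ∉ Set.range n → y = h i) := by
    intro i
    by_cases hi : i ∈ Set.range n
    · obtain ⟨k, rfl⟩ := hi
      refine ⟨f k, fun k' hk' => ?_, fun hk => absurd ⟨k, rfl⟩ hk⟩
      obtain rfl := hn.injective hk'
      rfl
    · exact ⟨h i, fun k hk => absurd ⟨k, hk⟩ hi, fun _ => rfl⟩
  choose g hg1 hg2 using hex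
  have hgn : ∀ k, g (n k) = f k := fun k => hg1 _ k rfl
  -- An eventual property may be checked separately on and off the subsequence.
  have hmerge : ∀ p : ℕ → Prop, (∀ᶠ k in atTop, p (n k)) → (∀ᶠ i in atTop, i ∉ Set.range n → p i) →
      ∀ᶠ i in atTop, p i := by
    intro p h1 h2
    obtain ⟨N, hN⟩ := eventually_atTop.1 h1
    filter_upwards [h2, eventually_ge_atTop (n N)] with i h3 h4
    by_cases hi : i ∈ Set.range n
    · obtain ⟨k, rfl⟩ := hi
      exact hN k (hn.le_iff_le.1 h4)
    · exact h3 hi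
  have hw := hh.weakConv hP
  refine ⟨g, hgn, hg2, ?_, fun φ => ?_⟩
  · obtain ⟨C, hC⟩ := hf.1
    obtain ⟨C', hC'⟩ := hw.1
    refine ⟨max C C', hmerge _ (hC.mono fun k hk => ?_) (hC'.mono fun i hi hin => ?_)⟩
    · rw [hgn]; exact hk.trans (le_max_left _ _)
    · rw [hg2 i hin]; exact hi.trans (le_max_right _ _)
  · rw [Filter.tendsto_def]
    intro s hs
    refine hmerge (fun i => inner ℝ (P i φ) (g i) ∈ s) ?_ ?_
    · filter_upwards [(hf.2 φ).eventually hs] with k hk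
      rw [hgn]; exact hk
    · filter_upwards [(hw.2 φ).eventually hs] with i hi hin
      rw [hg2 i hin]; exact hi

end VaryingHilbertSeq

/-! ### One coercive form: adjoint, form space, domain criterion, dual norm -/

section FormTheory
variable {H : Type*} [NormedAddCommGroup H] [InnerProductSpace ℝ H]

namespace CoerciveClosedForm
variable (E : CoerciveClosedForm H)

/-- The adjoint form `(f, g) ↦ a(g, f)`. -/
def flip : CoerciveClosedForm H where
  domain := E.domain
  dense_domain := E.dense_domain
  form := E.form.flip
  nonneg f := E.nonneg f
  sector := by
    obtain ⟨C, hC1, hC⟩ := E.sector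
    refine ⟨C, hC1, fun f g => ?_⟩
    have := hC g f
    simp only [shiftedForm, LinearMap.flip_apply] at this ⊢
    rw [real_inner_comm] at this
    linarith [mul_right_comm C √(E.form g g + 1 * inner ℝ (g : H) (g : H))
      √(E.form f f + 1 * inner ℝ (f : H) (f : H))]
  complete u hu := E.complete u hu

theorem shiftedForm_flip (α : ℝ) (f g : E.domain) :
    shiftedForm (F := E.domain) E.flip.form α f g = shiftedForm E.form α g f := by
  change E.form g f + α * inner ℝ (f : H) (g : H) = E.form g f + α * inner ℝ (g : H) (f : H)
  rw [real_inner_comm]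

theorem resolvent_mem {α : ℝ} (hα : 0 < α) (f : H) : E.resolvent α f ∈ E.domain :=
  (E.resolvent_spec hα f).1

theorem shiftedForm_resolvent {α : ℝ} (hα : 0 < α) (f : H) (g : E.domain) :
    shiftedForm E.form α ⟨E.resolvent α f, E.resolvent_mem hα f⟩ g = inner ℝ f (g : H) :=
  (E.resolvent_spec hα f).2 g

theorem shiftedForm_flip_resolvent {α : ℝ} (hα : 0 < α) (f : H) (g : E.domain) :
    shiftedForm E.form α g ⟨E.flip.resolvent α f, E.flip.resolvent_mem hα f⟩ =
      inner ℝ f (g : H) :=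
  (E.shiftedForm_flip α _ g).symm.trans (E.flip.shiftedForm_resolvent hα f g)

/-- Both sides equal $\mathcal E_\alpha(G_\alpha f,\hat G_\alpha g)$. -/
theorem inner_resolvent_left {α : ℝ} (hα : 0 < α) (f g : H) :
    inner ℝ (E.resolvent α f) g = inner ℝ f (E.flip.resolvent α g) := by
  rw [← E.shiftedForm_resolvent hα f ⟨_, E.flip.resolvent_mem hα g⟩,
    E.shiftedForm_flip_resolvent hα, real_inner_comm]

theorem eq_flip_resolvent {α : ℝ} (hα : 0 < α) (f : H) (v : E.domain)
    (h : ∀ g : E.domain, shiftedForm E.form α g v = inner ℝ f (g : H)) :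
    (v : H) = E.flip.resolvent α f := by
  have := E.flip.shifted_unique α hα v ⟨_, E.flip.resolvent_mem hα f⟩ fun g =>
    ((E.shiftedForm_flip α v g).trans (h g)).trans (E.flip.shiftedForm_resolvent hα f g).symm
  exact congrArg Subtype.val this

theorem norm_resolvent_le {α : ℝ} (hα : 0 < α) (f : H) : ‖E.resolvent α f‖ ≤ α⁻¹ * ‖f‖ := by
  have := E.resolvent_norm_le hα f
  rw [norm_smul, Real.norm_of_nonneg hα.le] at this
  rwa [← div_eq_inv_mul, le_div_iff₀ hα, mul_comm]

theorem shiftedForm_one_nonneg (f : E.domain) : 0 ≤ shiftedForm E.form 1 f f := by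
  rw [shifted_self]; nlinarith [E.nonneg f, sq_nonneg ‖(f : H)‖]

theorem domNorm_nonneg (f : E.domain) : 0 ≤ E.domNorm f := Real.sqrt_nonneg _

theorem domNorm_sq (f : E.domain) : E.domNorm f ^ 2 = shiftedForm E.form 1 f f :=
  Real.sq_sqrt (E.shiftedForm_one_nonneg f)

theorem norm_le_domNorm (f : E.domain) : ‖(f : H)‖ ≤ E.domNorm f := E.norm_le_sqrt f

theorem domNorm_eq_zero {f : E.domain} (h : E.domNorm f = 0) : f = 0 := by
  have := E.norm_le_domNorm f
  rw [h] at this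
  exact Subtype.ext (norm_le_zero_iff.1 this)

/-- The bilinear form `a_1`. -/
noncomputable def shiftedOne : E.domain →ₗ[ℝ] E.domain →ₗ[ℝ] ℝ :=
  E.form + (innerₗ H).domRestrict₁₂ E.domain E.domain

theorem shiftedOne_apply (f g : E.domain) : E.shiftedOne f g = shiftedForm E.form 1 f g := by
  simp only [shiftedOne, shiftedForm, LinearMap.add_apply, LinearMap.domRestrict₁₂_apply,
    innerₗ_apply_apply, one_mul]

theorem domNorm_smul (c : ℝ) (f : E.domain) : E.domNorm (c • f) = |c| * E.domNorm f := by
  rw [domNorm, domNorm, ← shiftedOne_apply, ← shiftedOne_apply]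
  simp only [map_smul, LinearMap.smul_apply, smul_eq_mul]
  rw [← mul_assoc, Real.sqrt_mul (mul_self_nonneg c), Real.sqrt_mul_self_eq_abs]

/-- The domain with the inner product given by the symmetric part of `a_1`. -/
def FormSpace (E : CoerciveClosedForm H) : Type _ := E.domain

instance : AddCommGroup E.FormSpace := inferInstanceAs (AddCommGroup E.domain)
instance : Module ℝ E.FormSpace := inferInstanceAs (Module ℝ E.domain)

/-- The identification of `FormSpace` with the domain. -/
def ofForm : E.FormSpace ≃ₗ[ℝ] E.domain := LinearEquiv.refl ℝ E.domain

/-- The inner product given by the symmetric part of `a_1`. -/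
@[reducible]
noncomputable def formCore : InnerProductSpace.Core ℝ E.FormSpace where
  inner f g := (1 / 2 : ℝ) *
    (E.shiftedOne (E.ofForm f) (E.ofForm g) + E.shiftedOne (E.ofForm g) (E.ofForm f))
  conj_inner_symm f g := by simp [add_comm]
  re_inner_nonneg f := by
    have : 0 ≤ E.shiftedOne (E.ofForm f) (E.ofForm f) := by
      rw [shiftedOne_apply]; exact E.shiftedForm_one_nonneg _
    simpa using this
  add_left f g h := by
    simp only [map_add, LinearMap.add_apply]; ring
  smul_left f g r := by
    simp only [map_smul, LinearMap.smul_apply, smul_eq_mul, conj_trivial]; ring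
  definite f hf := by
    have : E.shiftedOne (E.ofForm f) (E.ofForm f) = 0 := by linarith
    rw [shiftedOne_apply] at this
    exact E.ofForm.map_eq_zero_iff.1 (E.domNorm_eq_zero (by rw [domNorm, this, Real.sqrt_zero]))

noncomputable instance : NormedAddCommGroup E.FormSpace := E.formCore.toNormedAddCommGroup
noncomputable instance : InnerProductSpace ℝ E.FormSpace :=
  InnerProductSpace.ofCore E.formCore.toCore

theorem formSpace_inner (f g : E.FormSpace) : inner ℝ f g = (1 / 2 : ℝ) *
    (E.shiftedOne (E.ofForm f) (E.ofForm g) + E.shiftedOne (E.ofForm g) (E.ofForm f)) := rfl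

theorem formSpace_norm (f : E.FormSpace) : ‖f‖ = E.domNorm (E.ofForm f) := by
  rw [norm_eq_sqrt_real_inner, formSpace_inner, domNorm, shiftedOne_apply]
  congr 1; ring

instance : CompleteSpace E.FormSpace := by
  refine Metric.complete_of_cauchySeq_tendsto fun u hu => ?_
  obtain ⟨f, hf⟩ := E.complete (fun n => E.ofForm (u n)) fun ε hε => by
    obtain ⟨N, hN⟩ := Metric.cauchySeq_iff.1 hu ε hε
    refine ⟨N, fun m hm n hn => ?_⟩
    have := hN m hm n hn
    rwa [dist_eq_norm, formSpace_norm, map_sub] at this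
  refine ⟨E.ofForm.symm f, tendsto_iff_norm_sub_tendsto_zero.2 ?_⟩
  simpa only [formSpace_norm, map_sub, LinearEquiv.apply_symm_apply] using! hf

/-- The weak sector condition, for `a_1` as a bounded operator. -/
theorem exists_shiftedOne_eq_inner (v : E.FormSpace) :
    ∃ v' : E.domain, ∀ w : E.FormSpace, shiftedForm E.form 1 (E.ofForm w) v' = inner ℝ w v := by
  obtain ⟨C, hC1, hC⟩ := E.sector
  -- The form is flipped so that the Lax–Milgram solution stands in its second argument.
  let B : E.FormSpace →ₗ[ℝ] E.FormSpace →ₗ[ℝ] ℝ :=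
    (E.shiftedOne.compl₁₂ E.ofForm.toLinearMap E.ofForm.toLinearMap).flip
  have hB : ∀ f g, B f g = shiftedForm E.form 1 (E.ofForm g) (E.ofForm f) := fun f g =>
    E.shiftedOne_apply _ _
  let B' : E.FormSpace →L[ℝ] E.FormSpace →L[ℝ] ℝ := B.mkContinuous₂ C fun f g => by
    rw [formSpace_norm, formSpace_norm, Real.norm_eq_abs, hB]
    exact (hC _ _).trans_eq (mul_right_comm _ _ _)
  have hB' : IsCoercive B' := ⟨1, one_pos, fun f => by
    rw [one_mul, formSpace_norm, ← pow_two, domNorm_sq]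
    exact (hB f f).ge⟩
  refine ⟨E.ofForm (hB'.continuousLinearEquivOfBilin.symm v), fun w => ?_⟩
  have h := hB'.continuousLinearEquivOfBilin_apply (hB'.continuousLinearEquivOfBilin.symm v) w
  rw [ContinuousLinearEquiv.apply_symm_apply] at h
  rw [real_inner_comm, h]
  exact (hB _ _).symm

/-- The resolvent `G_1` as a map into the domain. -/
noncomputable def resolventOne : H →ₗ[ℝ] E.domain :=
  (E.resolvent 1).toLinearMap.codRestrict E.domain fun f => E.resolvent_mem one_pos f

theorem coe_resolventOne (k : H) : (E.resolventOne k : H) = E.resolvent 1 k := rfl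

theorem shiftedForm_resolventOne (k : H) (g : E.domain) :
    shiftedForm E.form 1 (E.resolventOne k) g = inner ℝ k (g : H) :=
  E.shiftedForm_resolvent one_pos k g

/-- For $v$ orthogonal to the range, write $\langle w,v\rangle=\mathcal E_1(w,v')$. Testing with
$w=G_1k$ gives $(k,v')=0$ for all $k$, so $v'=0$ and therefore $v=0$. -/
theorem denseRange_resolventOne :
    DenseRange (E.ofForm.symm.toLinearMap.comp E.resolventOne) := by
  have h : (LinearMap.range (E.ofForm.symm.toLinearMap.comp
      E.resolventOne)).topologicalClosure = ⊤ := by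
    rw [Submodule.topologicalClosure_eq_top_iff, eq_bot_iff]
    intro v hv
    obtain ⟨v', hv'⟩ := E.exists_shiftedOne_eq_inner v
    have h1 : ∀ k : H, inner ℝ k (v' : H) = 0 := fun k => by
      have h2 := hv' (E.ofForm.symm (E.resolventOne k))
      rw [LinearEquiv.apply_symm_apply, shiftedForm_resolventOne] at h2
      rw [h2]
      exact (Submodule.mem_orthogonal _ _).1 hv _ ⟨k, rfl⟩
    have h2 : v' = 0 := Subtype.ext (inner_self_eq_zero.1 (h1 v'))
    have h3 := hv' v
    rw [h2, ← shiftedOne_apply, map_zero] at h3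
    exact inner_self_eq_zero.1 h3.symm
  have h2 := Submodule.dense_iff_topologicalClosure_eq_top.2 h
  rwa [DenseRange, ← LinearMap.coe_range]

theorem exists_resolventOne_near (w : E.domain) {ε : ℝ} (hε : 0 < ε) :
    ∃ k : H, E.domNorm (w - E.resolventOne k) < ε := by
  obtain ⟨k, hk⟩ := E.denseRange_resolventOne.exists_dist_lt (E.ofForm.symm w) hε
  refine ⟨k, ?_⟩
  rw [dist_eq_norm, formSpace_norm, map_sub] at hk
  simpa using hk

/-- A vector lies in the domain if its pairings with `k` are dominated by the energy of `G_1 k`. -/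
theorem mem_domain_of_inner_le (f : H) (M : ℝ)
    (h : ∀ k : H, |inner ℝ k f| ≤ M * E.domNorm (E.resolventOne k)) : f ∈ E.domain := by
  -- By hypothesis $G_1k\mapsto(k,f)$ is bounded on a dense subspace of the form space. If $\mathcal
  -- E_1(\cdot,v')$ represents it, then $(k,f)=\mathcal E_1(G_1k,v')=(k,v')$ for all $k$.
  obtain ⟨v, hv⟩ := exists_inner_of_denseRange E.denseRange_resolventOne
    ((innerₗ H).flip f) M fun k => by
      rw [formSpace_norm, LinearMap.comp_apply, LinearEquiv.coe_coe, LinearEquiv.apply_symm_apply]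
      exact h k
  obtain ⟨v', hv'⟩ := E.exists_shiftedOne_eq_inner v
  have h1 : f = v' := by
    refine ext_inner_left ℝ fun k => ?_
    have h2 := (hv' (E.ofForm.symm (E.resolventOne k))).trans (hv k)
    rw [LinearEquiv.apply_symm_apply, shiftedForm_resolventOne] at h2
    exact h2.symm
  rw [h1]
  exact v'.2

/-- The energy of $G_1k$ is thus expressed by the resolvent alone and passes to the limit under
resolvent convergence. -/
theorem domNorm_resolventOne_sq (k : H) :
    E.domNorm (E.resolventOne k) ^ 2 = inner ℝ k (E.resolvent 1 k) := by
  rw [domNorm_sq, shiftedForm_resolventOne]; rfl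

theorem dualNorm_le {f : E.domain} {M : ℝ}
    (h : ∀ g : E.domain, shiftedForm E.form 1 g f ≤ M * E.domNorm g) :
    E.dualNorm f ≤ ENNReal.ofReal M := by
  rw [dualNorm, iInf_pos f.2]
  refine iSup₂_le fun g hg => ENNReal.ofReal_le_ofReal ?_
  simpa [hg] using h g

theorem mem_domain_of_dualNorm_lt_top {f : H} (h : E.dualNorm f < ∞) : f ∈ E.domain := by
  by_contra hf
  rw [dualNorm, iInf_neg hf] at h
  exact lt_irrefl _ h

theorem shiftedForm_le_of_dualNorm_le {f : E.domain} {M : ℝ} (hM : 0 ≤ M)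
    (h : E.dualNorm f ≤ ENNReal.ofReal M) (g : E.domain) :
    shiftedForm E.form 1 g f ≤ M * E.domNorm g := by
  rw [dualNorm, iInf_pos f.2, iSup₂_le_iff] at h
  rcases (E.domNorm_nonneg g).eq_or_lt with h0 | h0
  · rw [E.domNorm_eq_zero h0.symm, ← shiftedOne_apply]
    simp only [map_zero, LinearMap.zero_apply]
    exact mul_nonneg hM (E.domNorm_nonneg _)
  · have h1 := h ((E.domNorm g)⁻¹ • g) (by
      rw [domNorm_smul, abs_of_pos (inv_pos.2 h0), inv_mul_cancel₀ h0.ne'])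
    rw [ENNReal.ofReal_le_ofReal_iff hM, ← shiftedOne_apply, map_smul, LinearMap.smul_apply,
      smul_eq_mul, shiftedOne_apply, inv_mul_le_iff₀ h0] at h1
    linarith

/-- The normalized vector $f$ itself is a competitor in the supremum. -/
theorem energyNorm_le_dualNorm (f : H) : E.energyNorm f ≤ E.dualNorm f := by
  refine le_iInf fun hf => ?_
  refine (iInf_le _ hf).trans ?_
  rcases (E.domNorm_nonneg ⟨f, hf⟩).eq_or_lt with h0 | h0
  · rw [← h0]; simp
  · refine le_iSup₂_of_le ((E.domNorm ⟨f, hf⟩)⁻¹ • ⟨f, hf⟩) (by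
      rw [domNorm_smul, abs_of_pos (inv_pos.2 h0), inv_mul_cancel₀ h0.ne']) ?_
    refine ENNReal.ofReal_le_ofReal (le_of_eq ?_)
    rw [← shiftedOne_apply, map_smul, LinearMap.smul_apply, smul_eq_mul, shiftedOne_apply,
      ← domNorm_sq]
    field_simp

/-- Co-resolvents have bounded dual norm. -/
theorem dualNorm_flip_resolvent_le {α : ℝ} (hα : 0 < α) (f : H) :
    E.dualNorm (E.flip.resolvent α f) ≤ ENNReal.ofReal ((1 + |1 - α| * α⁻¹) * ‖f‖) := by
  refine E.dualNorm_le (f := ⟨_, E.flip.resolvent_mem hα f⟩) fun g => ?_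
  have h1 := E.shiftedForm_flip_resolvent hα f g
  -- Changing the shift from $\alpha$ to $1$ costs only an $L^2$ pairing. No sector constant enters,
  -- so the bound is uniform along a sequence of forms.
  have h2 : shiftedForm E.form 1 g ⟨_, E.flip.resolvent_mem hα f⟩ =
      inner ℝ f (g : H) + (1 - α) * inner ℝ (g : H) (E.flip.resolvent α f) := by
    rw [← h1, shiftedForm, shiftedForm]; ring
  rw [h2]
  have h3 : inner ℝ f (g : H) ≤ ‖f‖ * E.domNorm g := (real_inner_le_norm _ _).trans
    (mul_le_mul_of_nonneg_left (E.norm_le_domNorm g) (norm_nonneg _))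
  have h4 : |inner ℝ (g : H) (E.flip.resolvent α f)| ≤ E.domNorm g * (α⁻¹ * ‖f‖) :=
    (abs_real_inner_le_norm _ _).trans (mul_le_mul (E.norm_le_domNorm g)
      (E.flip.norm_resolvent_le hα f) (norm_nonneg _) (E.domNorm_nonneg g))
  have h5 : (1 - α) * inner ℝ (g : H) (E.flip.resolvent α f) ≤
      |1 - α| * (E.domNorm g * (α⁻¹ * ‖f‖)) :=
    (le_abs_self _).trans (by rw [abs_mul]; gcongr)
  linarith

end CoerciveClosedForm
end FormTheory

/-! ### One semigroup: Yosida approximation with an explicit rate -/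

section SemigroupTheory
variable {H : Type*} [NormedAddCommGroup H] [InnerProductSpace ℝ H]

namespace CoerciveClosedForm
variable (E : CoerciveClosedForm H)

/-- This is the resolvent identity rearranged: on the range of $G_1$ the operator $\alpha
G_\alpha-1$ gains a factor $G_\alpha$, of norm at most $1/\alpha$. -/
theorem resolvent_resolvent_sub {α : ℝ} (hα : 0 < α) (h : H) :
    α • E.resolvent α (E.resolvent 1 h) - E.resolvent 1 h =
      E.resolvent α (E.resolvent 1 h - h) := by
  have h1 := E.resolvent_sub hα one_pos h
  rw [sub_smul, one_smul] at h1
  rw [map_sub]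
  have h2 : ∀ a b x y : H, a - b = x - y → y - b = x - a := fun a b x y h => by
    rw [show y = x - (a - b) by rw [h]; abel]; abel
  exact h2 _ _ _ _ h1

theorem norm_resolvent_one_sub_le (h : H) : ‖E.resolvent 1 h - h‖ ≤ 2 * ‖h‖ := by
  have := E.norm_resolvent_le one_pos h
  rw [inv_one, one_mul] at this
  linarith [norm_sub_le (E.resolvent 1 h) h]

/-- The Yosida approximation `α (α G_α - 1)` of the generator. -/
noncomputable def yosida (α : ℝ) : H →L[ℝ] H := α • (α • E.resolvent α - 1)

theorem yosida_apply (α : ℝ) (f : H) : E.yosida α f = α • (α • E.resolvent α f - f) := rfl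

theorem norm_yosida_le {α : ℝ} (hα : 0 < α) (f : H) : ‖E.yosida α f‖ ≤ 2 * α * ‖f‖ := by
  rw [yosida_apply, norm_smul, Real.norm_of_nonneg hα.le]
  have h := norm_sub_le (α • E.resolvent α f) f
  have h1 := E.resolvent_norm_le hα f
  nlinarith

/-- The exponential is $e^{-t\alpha}e^{t\alpha^2G_\alpha}$, and $\|t\alpha^2G_\alpha\|\le t\alpha$.
-/
theorem norm_exp_yosida_le [CompleteSpace H] {α : ℝ} (hα : 0 < α) {t : ℝ} (ht : 0 ≤ t) :
    ‖NormedSpace.exp (t • E.yosida α)‖ ≤ 1 := by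
  have : t • E.yosida α = (t * α ^ 2) • E.resolvent α - (t * α) • (1 : H →L[ℝ] H) := by
    simp only [yosida, smul_sub, smul_smul, pow_two]
  rw [this]
  refine norm_opExp_sub_le _ _ ?_
  rw [norm_smul, Real.norm_of_nonneg (by positivity)]
  have h1 : ‖E.resolvent α‖ ≤ α⁻¹ :=
    ContinuousLinearMap.opNorm_le_bound _ (by positivity) (E.norm_resolvent_le hα)
  calc t * α ^ 2 * ‖E.resolvent α‖ ≤ t * α ^ 2 * α⁻¹ := by gcongr
    _ = t * α := by field_simp

/-- The Yosida approximation converges to the generator at an explicit rate on the range of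
`G_1 G_1`. -/
theorem norm_yosida_sub_le {α : ℝ} (hα : 0 < α) (g : H) :
    ‖(E.resolvent 1 (E.resolvent 1 g) - E.resolvent 1 g) -
      E.yosida α (E.resolvent 1 (E.resolvent 1 g))‖ ≤ 4 * ‖g‖ / α := by
  set k := E.resolvent 1 g - g with hk
  have h1 : E.resolvent 1 (E.resolvent 1 g) - E.resolvent 1 g = E.resolvent 1 k := by
    rw [hk, map_sub]
  -- The identity is used twice, hence the two factors $G_1$: once to cancel the factor $\alpha$ of
  -- the Yosida approximation, once to gain $1/\alpha$.
  rw [yosida_apply, E.resolvent_resolvent_sub hα, h1, norm_sub_rev, E.resolvent_resolvent_sub hα]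
  calc _ ≤ α⁻¹ * ‖E.resolvent 1 k - k‖ := E.norm_resolvent_le hα _
    _ ≤ α⁻¹ * (2 * (2 * ‖g‖)) := by
        gcongr
        exact (E.norm_resolvent_one_sub_le k).trans
          (mul_le_mul_of_nonneg_left (E.norm_resolvent_one_sub_le g) zero_le_two)
    _ = 4 * ‖g‖ / α := by ring

variable [CompleteSpace H]

theorem norm_semigroup_le {t : ℝ} (ht : 0 ≤ t) (f : H) : ‖E.semigroup t f‖ ≤ ‖f‖ :=
  ((E.semigroup t).le_of_opNorm_le (E.semigroup_spec.1.norm_le t ht) f).trans_eq (one_mul _)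

theorem semigroup_zero (f : H) : E.semigroup 0 f = f := by
  rw [E.semigroup_spec.1.zero]; rfl

theorem semigroup_add {s t : ℝ} (hs : 0 ≤ s) (ht : 0 ≤ t) (f : H) :
    E.semigroup (s + t) f = E.semigroup s (E.semigroup t f) := by
  rw [E.semigroup_spec.1.add s t hs ht]; rfl

theorem continuousOn_semigroup (f : H) : ContinuousOn (fun t => E.semigroup t f) (Set.Ici 0) :=
  E.semigroup_spec.1.continuousOn f

theorem aestronglyMeasurable_exp_smul_semigroup (α : ℝ) (f : H) :
    AEStronglyMeasurable (fun t => Real.exp (-α * t) • E.semigroup t f)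
      (volume.restrict (Set.Ioi 0)) :=
  (ContinuousOn.smul (by fun_prop) ((E.continuousOn_semigroup f).mono
    Set.Ioi_subset_Ici_self)).aestronglyMeasurable measurableSet_Ioi

theorem integrableOn_exp_smul_semigroup {α : ℝ} (hα : 0 < α) (f : H) :
    IntegrableOn (fun t => Real.exp (-α * t) • E.semigroup t f) (Set.Ioi 0) := by
  refine ((integrableOn_exp_mul_Ioi (neg_neg_of_pos hα) 0).mul_const ‖f‖).mono'
    (E.aestronglyMeasurable_exp_smul_semigroup α f) ?_
  refine (ae_restrict_iff' measurableSet_Ioi).2 (Eventually.of_forall fun t ht => ?_)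
  rw [norm_smul, Real.norm_of_nonneg (Real.exp_pos _).le]
  gcongr
  exact E.norm_semigroup_le (le_of_lt ht) f

theorem inner_resolvent_eq_integral {α : ℝ} (hα : 0 < α) (g f : H) :
    inner ℝ g (E.resolvent α f) =
      ∫ t in Set.Ioi 0, Real.exp (-α * t) * inner ℝ g (E.semigroup t f) := by
  rw [E.semigroup_spec.2 α hα f, ← integral_inner (E.integrableOn_exp_smul_semigroup hα f)]
  simp only [inner_smul_right]

theorem semigroup_resolvent_comm {α : ℝ} (hα : 0 < α) {s : ℝ} (hs : 0 ≤ s) (f : H) :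
    E.semigroup s (E.resolvent α f) = E.resolvent α (E.semigroup s f) := by
  rw [E.semigroup_spec.2 α hα, E.semigroup_spec.2 α hα,
    ← ContinuousLinearMap.integral_comp_comm _ (E.integrableOn_exp_smul_semigroup hα f)]
  refine setIntegral_congr_fun measurableSet_Ioi fun t ht => ?_
  have ht0 : (0 : ℝ) ≤ t := le_of_lt ht
  simp only [map_smul]
  rw [← E.semigroup_add hs ht0, add_comm, E.semigroup_add ht0 hs]

/-- Values at negative times are unconstrained; clamping the time gives an integrand continuous on
the whole line. -/
theorem continuous_semigroup_max (f : H) : Continuous fun t => E.semigroup (max t 0) f :=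
  (E.continuousOn_semigroup f).comp_continuous (by fun_prop) fun t => le_max_right t 0

/-- Shifting the Laplace integral gives $T_sG_1g=e^s\int_s^\infty e^{-t}T_tg\,dt$. Written with the
complementary integral over $[0,s]$, this is differentiable in $s$ by the fundamental theorem of
calculus. -/
theorem semigroup_resolvent_one {s : ℝ} (hs : 0 ≤ s) (g : H) :
    E.semigroup s (E.resolvent 1 g) = Real.exp s • (E.resolvent 1 g -
      ∫ t in (0 : ℝ)..s, Real.exp (-t) • E.semigroup (max t 0) g) := by
  have hint := E.integrableOn_exp_smul_semigroup one_pos g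
  simp only [neg_mul, one_mul] at hint
  have h1 : E.semigroup s (E.resolvent 1 g) =
      Real.exp s • ∫ t in Set.Ioi s, Real.exp (-t) • E.semigroup t g := by
    have h2 : ∫ t in Set.Ioi (0 : ℝ), Real.exp (-(t + s)) • E.semigroup (t + s) g =
        ∫ t in Set.Ioi s, Real.exp (-t) • E.semigroup t g := by
      have := (measurePreserving_add_right volume s).setIntegral_preimage_emb
        (measurableEmbedding_addRight s) (fun t => Real.exp (-t) • E.semigroup t g) (Set.Ioi s)
      rwa [Set.preimage_add_const_Ioi, sub_self] at this
    rw [← h2, ← integral_smul, E.semigroup_spec.2 1 one_pos,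
      ← ContinuousLinearMap.integral_comp_comm _ (E.integrableOn_exp_smul_semigroup one_pos g)]
    refine setIntegral_congr_fun measurableSet_Ioi fun t ht => ?_
    have ht0 : (0 : ℝ) ≤ t := le_of_lt ht
    simp only [map_smul, smul_smul]
    rw [← Real.exp_add, ← E.semigroup_add hs ht0, add_comm s t]
    congr 2; ring
  have h3 : E.resolvent 1 g = (∫ t in (0 : ℝ)..s, Real.exp (-t) • E.semigroup (max t 0) g) +
      ∫ t in Set.Ioi s, Real.exp (-t) • E.semigroup t g := by
    rw [E.semigroup_spec.2 1 one_pos, intervalIntegral.integral_of_le hs]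
    simp only [neg_mul, one_mul]
    rw [← Set.Ioc_union_Ioi_eq_Ioi hs, setIntegral_union Set.Ioc_disjoint_Ioi_same
      measurableSet_Ioi (hint.mono_set Set.Ioc_subset_Ioi_self)
      (hint.mono_set (Set.Ioi_subset_Ioi hs))]
    congr 1
    refine setIntegral_congr_fun measurableSet_Ioc fun t ht => ?_
    simp only [max_eq_left ht.1.le]
  rw [h1]
  congr 1
  rw [h3, add_sub_cancel_left]

/-- On the range of `G_1` the semigroup is differentiable with the expected derivative. -/
theorem hasDerivWithinAt_semigroup {s : ℝ} (hs : 0 ≤ s) (g : H) :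
    HasDerivWithinAt (fun s => E.semigroup s (E.resolvent 1 g))
      (E.semigroup s (E.resolvent 1 g - g)) (Set.Ici 0) s := by
  have hc : Continuous fun t => Real.exp (-t) • E.semigroup (max t 0) g :=
    (by fun_prop : Continuous fun t : ℝ => Real.exp (-t)).smul (E.continuous_semigroup_max g)
  have h1 : HasDerivAt (fun s => ∫ t in (0 : ℝ)..s, Real.exp (-t) • E.semigroup (max t 0) g)
      (Real.exp (-s) • E.semigroup (max s 0) g) s :=
    intervalIntegral.integral_hasDerivAt_right (hc.intervalIntegrable _ _)
      (hc.stronglyMeasurableAtFilter _ _) hc.continuousAt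
  have h2 := (Real.hasDerivAt_exp s).smul (h1.const_sub (E.resolvent 1 g))
  refine (h2.hasDerivWithinAt.congr_deriv ?_).congr
    (fun t ht => E.semigroup_resolvent_one ht g) (E.semigroup_resolvent_one hs g)
  rw [← E.semigroup_resolvent_one hs, smul_neg, smul_smul, ← Real.exp_add, add_neg_cancel,
    Real.exp_zero, one_smul, max_eq_left hs, map_sub]
  abel

/-- The semigroup is approximated by the exponentials of the Yosida approximations, with a bound
that depends on the form only through the vector. -/
theorem norm_semigroup_sub_exp_yosida_le {α : ℝ} (hα : 0 < α) {t : ℝ} (ht : 0 ≤ t) (g : H) :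
    ‖E.semigroup t (E.resolvent 1 (E.resolvent 1 g)) -
      NormedSpace.exp (t • E.yosida α) (E.resolvent 1 (E.resolvent 1 g))‖ ≤
      4 * ‖g‖ / α * t := by
  set u := E.resolvent 1 (E.resolvent 1 g) with hu
  set A := E.yosida α with hA
  -- Duhamel interpolation: $e^{(t-s)A}T_su$ runs from $e^{tA}u$ to $T_tu$. Its derivative is
  -- $e^{(t-s)A}T_s(Lu-Au)$ with $Lu=u-G_1g$, and both outer operators are contractions.
  have hd : ∀ s ∈ Set.Icc 0 t, HasDerivWithinAt
      (fun s : ℝ => NormedSpace.exp ((t - s) • A) (E.semigroup s u))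
      (NormedSpace.exp ((t - s) • A) (E.semigroup s ((u - E.resolvent 1 g) - A u)))
      (Set.Icc 0 t) s := by
    intro s hs
    have h1 := (hasDerivAt_exp_smul_const (𝕂 := ℝ) A (t - s)).scomp s
      ((hasDerivAt_id s).const_sub t)
    have h2 := (E.hasDerivWithinAt_semigroup hs.1 (E.resolvent 1 g)).mono
      (Set.Icc_subset_Ici_self : Set.Icc 0 t ⊆ Set.Ici 0)
    refine (h1.hasDerivWithinAt.clm_apply h2).congr_deriv ?_
    have hc : A (E.semigroup s u) = E.semigroup s (A u) := by
      rw [hA, yosida_apply, yosida_apply, map_smul, map_sub, map_smul,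
        E.semigroup_resolvent_comm hα hs.1]
    change (-1 : ℝ) • NormedSpace.exp ((t - s) • A) (A (E.semigroup s u)) +
      NormedSpace.exp ((t - s) • A) (E.semigroup s (u - E.resolvent 1 g)) = _
    rw [hc, map_sub (E.semigroup s) _ (A u), map_sub (NormedSpace.exp ((t - s) • A)), neg_one_smul]
    exact neg_add_eq_sub _ _
  have h := norm_image_sub_le_of_norm_deriv_le_segment' hd (C := 4 * ‖g‖ / α) (fun s hs => ?_) t
    ⟨ht, le_rfl⟩
  · simpa [NormedSpace.exp_zero, E.semigroup_zero] using h
  · calc _ ≤ 1 * ‖E.semigroup s ((u - E.resolvent 1 g) - A u)‖ :=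
          ContinuousLinearMap.le_of_opNorm_le _
            (E.norm_exp_yosida_le hα (sub_nonneg.2 hs.2.le)) _
      _ ≤ ‖(u - E.resolvent 1 g) - A u‖ := by
          rw [one_mul]; exact E.norm_semigroup_le hs.1 _
      _ ≤ _ := E.norm_yosida_sub_le hα g

end CoerciveClosedForm
end SemigroupTheory

/-! ### Strong convergence of exponentials of bounded operators -/

section StrongExp
variable {I : Type*} {V : Type*} [AddCommGroup V] [Module ℝ V]
  {H : I → Type*} [∀ i, NormedAddCommGroup (H i)] [∀ i, InnerProductSpace ℝ (H i)]
  [∀ i, CompleteSpace (H i)]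
  {K : Type*} [NormedAddCommGroup K] [InnerProductSpace ℝ K] [CompleteSpace K]

theorem hasSum_inner_exp_smul {F : Type*} [NormedAddCommGroup F] [InnerProductSpace ℝ F]
    [CompleteSpace F] (B : F →L[ℝ] F) (t : ℝ) (u g : F) :
    HasSum (fun m : ℕ => ((m.factorial : ℝ)⁻¹ * t ^ m) * inner ℝ g ((B ^ m) u))
      (inner ℝ g (NormedSpace.exp (t • B) u)) := by
  have h1 := NormedSpace.exp_series_hasSum_exp' (𝕂 := ℝ) (t • B)
  have h2 := h1.mapL ((innerSL ℝ g).comp (ContinuousLinearMap.apply ℝ F u))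
  have h3 : ∀ m : ℕ, ((m.factorial : ℝ)⁻¹ * t ^ m) * inner ℝ g ((B ^ m) u) =
      (innerSL ℝ g).comp (ContinuousLinearMap.apply ℝ F u) ((m.factorial : ℝ)⁻¹ • (t • B) ^ m) := by
    intro m
    simp [smul_pow, mul_assoc]
  simp only [h3]
  exact h2

/-- Strong convergence of exponentials follows from that of the powers. -/
theorem strongConv_exp {l : Filter I} {P : ∀ i, V →ₗ[ℝ] H i} {Q : V →ₗ[ℝ] K}
    (hP : AsymptoticIsometry l P Q) {B : ∀ i, H i →L[ℝ] H i} {B' : K →L[ℝ] K} {t : I → ℝ} {s : ℝ}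
    {u : ∀ i, H i} {u' : K} {R M : ℝ} (hM : 0 ≤ M) (ht : Tendsto t l (𝓝 s))
    (hR : ∀ᶠ i in l, |t i| ≤ R)
    (hB : ∀ i v, ‖B i v‖ ≤ M * ‖v‖)
    (hu : ∀ m : ℕ, StrongConv l P Q (fun i => (B i ^ m) (u i)) ((B' ^ m) u')) :
    StrongConv l P Q (fun i => NormedSpace.exp (t i • B i) (u i))
      (NormedSpace.exp (s • B') u') := by
  have hu0 : StrongConv l P Q u u' := by simpa using hu 0
  refine strongConv_of_tendsto_inner hP ⟨Real.exp (R * M) * (‖u'‖ + 1), ?_⟩ fun g g' hg => ?_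
  · filter_upwards [hR, hu0.eventually_norm_le] with i h1 h2
    have h3 : ‖t i • B i‖ ≤ R * M := by
      rw [norm_smul, Real.norm_eq_abs]
      exact mul_le_mul h1 (ContinuousLinearMap.opNorm_le_bound _ hM (hB i)) (norm_nonneg _)
        ((abs_nonneg _).trans h1)
    exact (ContinuousLinearMap.le_opNorm _ _).trans (mul_le_mul
      ((norm_opExp_le _).trans (Real.exp_le_exp.2 h3)) h2 (norm_nonneg _) (Real.exp_pos _).le)
  · simp only [← (hasSum_inner_exp_smul _ _ _ _).tsum_eq]
    -- Against a weakly convergent sequence the exponential series is a scalar series, dominated by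
    -- a multiple of $(RM)^m/m!$. Its terms converge because the powers do.
    obtain ⟨C, hC⟩ := hg.1
    have hsum : Summable fun m : ℕ => ((m.factorial : ℝ)⁻¹ * (R * M) ^ m) * (|C| * (‖u'‖ + 1)) := by
      refine Summable.mul_right _ ?_
      simpa only [div_eq_inv_mul] using Real.summable_pow_div_factorial (R * M)
    refine tendsto_tsum_of_dominated_convergence hsum (fun m => ?_) ?_
    · refine (tendsto_const_nhds.mul (ht.pow m)).mul ?_
      simpa only [real_inner_comm] using (hu m).tendsto_inner hg hP
    · filter_upwards [hR, hC, hu0.eventually_norm_le] with i h1 h2 h3 m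
      have hpow : ∀ m : ℕ, ‖(B i ^ m) (u i)‖ ≤ M ^ m * (‖u'‖ + 1) := by
        intro m
        induction m with
        | zero => simpa using h3
        | succ m ih =>
          rw [pow_succ']
          calc ‖B i ((B i ^ m) (u i))‖ ≤ M * (M ^ m * (‖u'‖ + 1)) :=
                (hB i _).trans (mul_le_mul_of_nonneg_left ih hM)
            _ = _ := by ring
      have hR0 : 0 ≤ R := (abs_nonneg _).trans h1
      rw [norm_mul, norm_mul, norm_pow, Real.norm_eq_abs (t i), norm_inv, RCLike.norm_natCast,
        Real.norm_eq_abs]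
      have h4 : |inner ℝ (g i) ((B i ^ m) (u i))| ≤ |C| * (M ^ m * (‖u'‖ + 1)) :=
        (abs_real_inner_le_norm _ _).trans
          (mul_le_mul (h2.trans (le_abs_self C)) (hpow m) (norm_nonneg _) (abs_nonneg _))
      calc _ ≤ ((m.factorial : ℝ)⁻¹ * R ^ m) * (|C| * (M ^ m * (‖u'‖ + 1))) := by gcongr
        _ = _ := by rw [mul_pow]; ring

end StrongExp

/-- `WeakL2` asks for a bound on the whole sequence, `WeakConv` only for an eventual one. -/
theorem exists_norm_le_of_eventually {H : ℕ → Type*} [∀ i, NormedAddCommGroup (H i)] {f : ∀ n, H n}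
    (h : ∃ C, ∀ᶠ n in atTop, ‖f n‖ ≤ C) :
    ∃ C, ∀ n, ‖f n‖ ≤ C := by
  obtain ⟨C, hC⟩ := h
  obtain ⟨B, hB⟩ := (isBoundedUnder_of_eventually_le (f := atTop) (u := fun n => ‖f n‖)
    hC).bddAbove_range
  exact ⟨B, fun n => hB ⟨n, rfl⟩⟩

/-! ### Sequences of forms: the implications between the conditions -/

section VaryingForms
variable {V : Type*} [AddCommGroup V] [Module ℝ V]
  {H : ℕ → Type*} [∀ i, NormedAddCommGroup (H i)] [∀ i, InnerProductSpace ℝ (H i)]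
  {K : Type*} [NormedAddCommGroup K] [InnerProductSpace ℝ K]
  {P : ∀ i, V →ₗ[ℝ] H i} {Q : V →ₗ[ℝ] K}
  {E : ∀ n, CoerciveClosedForm (H n)} {EL : CoerciveClosedForm K}

namespace CoerciveClosedForm

theorem sqrt_inner_resolvent {H : Type*} [NormedAddCommGroup H] [InnerProductSpace ℝ H]
    (E : CoerciveClosedForm H) (k : H) :
    √(inner ℝ k (E.resolvent 1 k)) = E.domNorm (E.resolventOne k) := by
  rw [← E.domNorm_resolventOne_sq, Real.sqrt_sq (E.domNorm_nonneg _)]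

/-- The constant depends on the form through its sector condition. This is harmless because the
estimate serves only for the limit form. -/
theorem exists_abs_shiftedForm_le {H : Type*} [NormedAddCommGroup H] [InnerProductSpace ℝ H]
    (E : CoerciveClosedForm H) (α : ℝ) (v : E.domain) :
    ∃ C, 0 ≤ C ∧ ∀ g, |shiftedForm E.form α g v| ≤ C * E.domNorm g := by
  obtain ⟨C, hC1, hC⟩ := E.sector
  refine ⟨C * E.domNorm v + |α - 1| * ‖(v : H)‖, by
    have := E.domNorm_nonneg v; positivity, fun g => ?_⟩
  have h1 : shiftedForm E.form α g v =
      shiftedForm E.form 1 g v + (α - 1) * inner ℝ (g : H) (v : H) := by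
    rw [shiftedForm, shiftedForm]; ring
  have h2 : |inner ℝ (g : H) (v : H)| ≤ E.domNorm g * ‖(v : H)‖ :=
    (abs_real_inner_le_norm _ _).trans
      (mul_le_mul_of_nonneg_right (E.norm_le_domNorm g) (norm_nonneg _))
  have h3 : |shiftedForm E.form 1 g v| ≤ C * E.domNorm g * E.domNorm v := hC g v
  rw [h1]
  calc _ ≤ |shiftedForm E.form 1 g v| + |α - 1| * |inner ℝ (g : H) (v : H)| := by
        rw [← abs_mul]; exact abs_add_le _ _
    _ ≤ C * E.domNorm g * E.domNorm v + |α - 1| * (E.domNorm g * ‖(v : H)‖) := by gcongr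
    _ = _ := by ring

/-- The range of $G_1$ is dense because it is dense in the domain for the stronger form norm.
Applying the contraction $G_1$ to an approximation of $k$ gives density of the range of $G_1G_1$. -/
theorem exists_resolvent_resolvent_near {H : Type*} [NormedAddCommGroup H] [InnerProductSpace ℝ H]
    (E : CoerciveClosedForm H) (f : H) {ε : ℝ} (hε : 0 < ε) :
    ∃ h, ‖f - E.resolvent 1 (E.resolvent 1 h)‖ < ε := by
  have key : ∀ (f : H) {ε : ℝ}, 0 < ε → ∃ h, ‖f - E.resolvent 1 h‖ < ε := by
    intro f ε hε
    obtain ⟨w, hw, hwf⟩ := Metric.mem_closure_iff.1 (E.dense_domain f) (ε / 2) (by positivity)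
    obtain ⟨k, hk⟩ := E.exists_resolventOne_near ⟨w, hw⟩ (half_pos hε)
    refine ⟨k, ?_⟩
    rw [dist_eq_norm] at hwf
    have h1 : ‖w - E.resolvent 1 k‖ < ε / 2 := (E.norm_le_domNorm _).trans_lt hk
    calc _ ≤ ‖f - w‖ + ‖w - E.resolvent 1 k‖ := norm_sub_le_norm_sub_add_norm_sub _ _ _
      _ < ε := by linarith
  obtain ⟨k, hk⟩ := key f (half_pos hε)
  obtain ⟨h, hh⟩ := key k (half_pos hε)
  refine ⟨h, ?_⟩
  have h1 := E.norm_resolvent_le one_pos (k - E.resolvent 1 h)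
  rw [map_sub, inv_one, one_mul] at h1
  calc _ ≤ ‖f - E.resolvent 1 k‖ + ‖E.resolvent 1 k - E.resolvent 1 (E.resolvent 1 h)‖ :=
        norm_sub_le_norm_sub_add_norm_sub _ _ _
    _ < ε := by linarith

end CoerciveClosedForm

/-- Strong resolvent convergence implies that weak limits of sequences with finite lower limit of the
dual norms lie in the domain. -/
theorem mem_domain_of_resolventConv (hP : AsymptoticIsometry atTop P Q)
    (hR : ∀ (f : ∀ n, H n) (fL : K), StrongConv atTop P Q f fL →
      StrongConv atTop P Q (fun n => (E n).resolvent 1 (f n)) (EL.resolvent 1 fL))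
    {f : ∀ n, H n} {fL : K} (hf : WeakConv atTop P Q f fL)
    (hlim : liminf (fun n => (E n).dualNorm (f n)) atTop < ∞) : fL ∈ EL.domain := by
  obtain ⟨M', hM'1, hM'2⟩ := exists_between hlim
  have hfr : ∃ᶠ n in atTop, (E n).dualNorm (f n) < M' :=
    frequently_lt_of_liminf_lt (by isBoundedDefault) hM'1
  set M := M'.toReal with hM
  have hMM : ENNReal.ofReal M = M' := ENNReal.ofReal_toReal hM'2.ne
  have hM0 : 0 ≤ M := ENNReal.toReal_nonneg
  -- The dual bound tested on $G_1h_n$ is $(h_n,f_n)\le M(h_n,G_1h_n)^{1/2}$, and both sides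
  -- converge. If the limit inequality failed, the bound would fail for all large $n$, whereas it
  -- holds infinitely often.
  have key : ∀ k : K, inner ℝ k fL ≤ M * EL.domNorm (EL.resolventOne k) := by
    intro k
    obtain ⟨h, hh⟩ := hP.exists_strongConv k
    have h1 := hh.tendsto_inner hf hP
    have h2 := (Real.continuous_sqrt.tendsto _).comp
      (hh.tendsto_inner ((hR h k hh).weakConv hP) hP)
    by_contra! hlt
    rw [← EL.sqrt_inner_resolvent] at hlt
    have h4 := h1.sub (h2.const_mul M)
    refine hfr ?_
    filter_upwards [h4.eventually (lt_mem_nhds (sub_pos.2 hlt))] with n hn hlt'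
    have hdom := (E n).mem_domain_of_dualNorm_lt_top (hlt'.trans hM'2)
    have h5 := (E n).shiftedForm_le_of_dualNorm_le (f := ⟨f n, hdom⟩) hM0
      (by rw [hMM]; exact hlt'.le) ((E n).resolventOne (h n))
    rw [(E n).shiftedForm_resolventOne, ← (E n).sqrt_inner_resolvent] at h5
    simp only [Function.comp_apply] at hn
    linarith
  refine EL.mem_domain_of_inner_le fL M fun k => abs_le.2 ⟨?_, key k⟩
  have h1 := key (-k)
  rw [inner_neg_left, map_neg, ← neg_one_smul ℝ (EL.resolventOne k), EL.domNorm_smul, abs_neg,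
    abs_one, one_mul] at h1
  linarith

/-- Strong resolvent convergence yields recovery sequences for the forms. -/
theorem exists_recovery_of_resolventConv (hP : AsymptoticIsometry atTop P Q)
    (hR : ∀ (f : ∀ n, H n) (fL : K), StrongConv atTop P Q f fL →
      StrongConv atTop P Q (fun n => (E n).resolvent 1 (f n)) (EL.resolvent 1 fL))
    (f : ∀ n, (E n).domain) (fL wL : EL.domain)
    (hf : WeakConv atTop P Q (fun n => (f n : H n)) (fL : K)) :
    ∃ w : ∀ n, (E n).domain, StrongConv atTop P Q (fun n => (w n : H n)) (wL : K) ∧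
      Tendsto (fun n => (E n).form (w n) (f n)) atTop (𝓝 (EL.form wL fL)) := by
  obtain ⟨C, hC0, hC⟩ := EL.exists_abs_shiftedForm_le 1 fL
  choose k hk using fun j : ℕ =>
    EL.exists_resolventOne_near wL (Nat.one_div_pos_of_nat (n := j) (α := ℝ))
  choose h hh using fun j => hP.exists_strongConv (k j)
  obtain ⟨w₀, hw₀⟩ := hP.exists_strongConv (wL : K)
  -- For fixed $j$ the limits of the two errors are at most the form distance from $w$ to $G_1k_j$,
  -- respectively $C$ times it. The factor $C+1$ keeps the second inequality strict when $C=0$.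
  obtain ⟨d, hd, hdn⟩ := exists_tendsto_atTop_eventually_diag
    (p := fun j n => ‖(E n).resolvent 1 (h j n) - w₀ n‖ < 1 / ((j : ℝ) + 1) ∧
      |inner ℝ (h j n) (f n : H n) - shiftedForm EL.form 1 wL fL| < (C + 1) * (1 / ((j : ℝ) + 1)))
    fun j => by
      refine Eventually.and ?_ ?_
      · refine (((hR _ _ (hh j)).sub hw₀ hP).tendsto_norm).eventually (gt_mem_nhds ?_)
        rw [norm_sub_rev]
        exact (EL.norm_le_domNorm _).trans_lt (hk j)
      · refine (((hh j).tendsto_inner hf hP).sub_const _).abs.eventually (gt_mem_nhds ?_)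
        rw [← EL.shiftedForm_resolventOne, ← EL.shiftedOne_apply, ← EL.shiftedOne_apply, abs_sub_comm,
          ← LinearMap.sub_apply, ← map_sub, EL.shiftedOne_apply]
        have h1 : (0 : ℝ) < 1 / ((j : ℝ) + 1) := Nat.one_div_pos_of_nat
        calc _ ≤ C * EL.domNorm (wL - EL.resolventOne (k j)) := hC _
          _ ≤ C * (1 / ((j : ℝ) + 1)) := by gcongr; exact (hk j).le
          _ < _ := by linarith
  have hz : Tendsto (fun n => 1 / ((d n : ℝ) + 1)) atTop (𝓝 0) :=
    (tendsto_one_div_add_atTop_nhds_zero_nat (𝕜 := ℝ)).comp hd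
  have hw : StrongConv atTop P Q (fun n => (E n).resolvent 1 (h (d n) n)) (wL : K) :=
    hw₀.of_norm_sub_tendsto_zero (squeeze_zero' (Eventually.of_forall fun n => norm_nonneg _)
      (hdn.mono fun n hn => hn.1.le) hz)
  have hi : Tendsto (fun n => inner ℝ (h (d n) n) (f n : H n)) atTop
      (𝓝 (shiftedForm EL.form 1 wL fL)) := by
    rw [tendsto_iff_norm_sub_tendsto_zero]
    refine squeeze_zero' (Eventually.of_forall fun n => norm_nonneg _)
      (hdn.mono fun n hn => hn.2.le) ?_
    simpa using hz.const_mul (C + 1)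
  refine ⟨fun n => (E n).resolventOne (h (d n) n), hw, ?_⟩
  have h1 := hi.sub (hw.tendsto_inner hf hP)
  have h2 : shiftedForm EL.form 1 wL fL - inner ℝ (wL : K) (fL : K) = EL.form wL fL := by
    rw [shiftedForm]; ring
  rw [h2] at h1
  refine h1.congr fun n => ?_
  rw [← (E n).shiftedForm_resolventOne, shiftedForm, (E n).coe_resolventOne]; ring

/-- Weakly convergent subsequences in the domains extend to weakly convergent sequences in the
domains. -/
theorem exists_weakConv_extend_domain (hP : AsymptoticIsometry atTop P Q) {n : ℕ → ℕ}
    (hn : StrictMono n) (f : ∀ k, (E (n k)).domain) {fL : K}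
    (hf : WeakConv atTop (fun k => P (n k)) Q (fun k => (f k : H (n k))) fL) :
    ∃ g : ∀ i, (E i).domain, (∀ k, g (n k) = f k) ∧
      WeakConv atTop P Q (fun i => (g i : H i)) fL := by
  obtain ⟨h₀, hh₀⟩ := hP.exists_strongConv fL
  -- The entries off the subsequence must also lie in the domains, so a strongly convergent sequence
  -- is perturbed into them by $1/(i+1)$.
  have hex : ∀ i, ∃ d ∈ (E i).domain, ‖d - h₀ i‖ < 1 / ((i : ℝ) + 1) := fun i => by
    obtain ⟨d, hd, hdi⟩ := Metric.mem_closure_iff.1 ((E i).dense_domain (h₀ i)) _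
      (Nat.one_div_pos_of_nat (n := i) (α := ℝ))
    exact ⟨d, hd, by rwa [← dist_eq_norm, dist_comm]⟩
  choose h hhd hhn using hex
  have hh : StrongConv atTop P Q h fL := hh₀.of_norm_sub_tendsto_zero
    (squeeze_zero (fun _ => norm_nonneg _) (fun i => (hhn i).le)
      tendsto_one_div_add_atTop_nhds_zero_nat)
  obtain ⟨g, hg1, hg2, hg⟩ := hf.extend hP hn hh
  have hgd : ∀ i, g i ∈ (E i).domain := fun i => by
    by_cases hi : i ∈ Set.range n
    · obtain ⟨k, rfl⟩ := hi
      rw [hg1]; exact (f k).2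
    · rw [hg2 i hi]; exact hhd i
  exact ⟨fun i => ⟨g i, hgd i⟩, fun k => Subtype.ext (hg1 k), hg⟩

section Converse
variable [CompleteSpace K] [TopologicalSpace.SeparableSpace K]

/-- Under the Mosco-type conditions the co-resolvents preserve weak convergence. -/
theorem weakConv_flip_resolvent (hP : AsymptoticIsometry atTop P Q)
    (hF1 : ∀ (f : ∀ n, H n) (fL : K), WeakConv atTop P Q f fL →
      liminf (fun n => (E n).dualNorm (f n)) atTop < ∞ → fL ∈ EL.domain)
    (hF2 : ∀ n : ℕ → ℕ, StrictMono n → ∀ (f : ∀ k, (E (n k)).domain) (fL : EL.domain),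
      WeakConv atTop (fun k => P (n k)) Q (fun k => (f k : H (n k))) (fL : K) →
      (⨆ k, (E (n k)).dualNorm (f k)) < ∞ →
      ∃ C : Set EL.domain, (∀ v, ∀ ε > 0, ∃ w ∈ C, EL.domNorm (v - w) < ε) ∧
        ∀ w ∈ C, ∃ u : ∀ k, (E (n k)).domain,
          StrongConv atTop (fun k => P (n k)) Q (fun k => (u k : H (n k))) (w : K) ∧
          liminf (fun k => (((E (n k)).form (u k) (f k) : ℝ) : EReal)) atTop ≤
            ((EL.form w fL : ℝ) : EReal))
    {α : ℝ} (hα : 0 < α) {f : ∀ n, H n} {fL : K} (hf : WeakConv atTop P Q f fL) :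
    WeakConv atTop P Q (fun n => (E n).flip.resolvent α (f n)) (EL.flip.resolvent α fL) := by
  obtain ⟨B, hB⟩ := exists_norm_le_of_eventually hf.1
  set v : ∀ n, H n := fun n => (E n).flip.resolvent α (f n) with hv
  have hvB : ∀ n, ‖v n‖ ≤ α⁻¹ * B := fun n =>
    ((E n).flip.norm_resolvent_le hα _).trans (by gcongr; exact hB n)
  set M := (1 + |1 - α| * α⁻¹) * B with hM
  have hvM : ∀ n, (E n).dualNorm (v n) ≤ ENNReal.ofReal M := fun n =>
    ((E n).dualNorm_flip_resolvent_le hα _).trans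
      (ENNReal.ofReal_le_ofReal (by rw [hM]; gcongr; exact hB n))
  -- Every weak subsequential limit is identified as $\hat G_\alpha f$.
  have key : ∀ (n : ℕ → ℕ) (vL : K), StrictMono n →
      WeakConv atTop (fun k => P (n k)) Q (fun k => v (n k)) vL → vL = EL.flip.resolvent α fL := by
    intro n vL hn hw
    obtain ⟨h, hh⟩ := hP.exists_strongConv vL
    -- `hF1` concerns full sequences. Its lower limit stays finite after the extension, since the
    -- bound holds along the subsequence.
    obtain ⟨g, hg1, -, hg⟩ := hw.extend hP hn hh
    have hvL : vL ∈ EL.domain := by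
      refine hF1 g vL hg (lt_of_le_of_lt ?_ (ENNReal.ofReal_lt_top (r := M)))
      refine liminf_le_of_frequently_le' (hn.tendsto_atTop.frequently
        (Eventually.of_forall fun k => ?_).frequently)
      rw [hg1]; exact hvM _
    obtain ⟨C, hCd, hC⟩ := hF2 n hn (fun k => ⟨v (n k), (E (n k)).flip.resolvent_mem hα _⟩)
      ⟨vL, hvL⟩ hw (lt_of_le_of_lt (iSup_le fun k => hvM _) ENNReal.ofReal_lt_top)
    obtain ⟨A, hA0, hA⟩ := EL.exists_abs_shiftedForm_le α ⟨vL, hvL⟩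
    -- The co-resolvent equation rewrites $\mathcal E_n(u_k,v_{n_k})$ as
    -- $(u_k,f_{n_k})-\alpha(u_k,v_{n_k})$. Strong against weak convergence makes this converge, so
    -- the lower limit is a limit.
    have hpos : ∀ w ∈ C, inner ℝ fL (w : K) ≤ shiftedForm EL.form α w ⟨vL, hvL⟩ := by
      intro w hwC
      obtain ⟨u, hu, hlim⟩ := hC w hwC
      have hPn := hP.comp hn.tendsto_atTop
      have h1 := (hu.tendsto_inner (hf.comp hn.tendsto_atTop) hPn).sub
        ((hu.tendsto_inner hw hPn).const_mul α)
      have h2 : ∀ k, (E (n k)).form (u k) ⟨v (n k), (E (n k)).flip.resolvent_mem hα _⟩ =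
          inner ℝ (u k : H (n k)) (f (n k)) - α * inner ℝ (u k : H (n k)) (v (n k)) := by
        intro k
        rw [real_inner_comm, ← (E (n k)).shiftedForm_flip_resolvent hα (f (n k)) (u k), shiftedForm]
        ring
      simp only [h2] at hlim
      have h3 := (continuous_coe_real_ereal.tendsto _).comp h1
      rw [Function.comp_def] at h3
      rw [h3.liminf_eq, EReal.coe_le_coe_iff] at hlim
      rw [shiftedForm, real_inner_comm]
      linarith
    have hpos' : ∀ w : EL.domain, inner ℝ fL (w : K) ≤ shiftedForm EL.form α w ⟨vL, hvL⟩ := by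
      intro w
      refine le_of_forall_pos_le_add fun ε hε => ?_
      -- `A` controls the change of the shifted form and `‖fL‖` that of the pairing; the added `1`
      -- keeps the denominator positive.
      obtain ⟨w', hw'C, hw'⟩ := hCd w (ε / (A + ‖fL‖ + 1)) (by positivity)
      have h1 := hpos w' hw'C
      have h2 := (abs_le.1 (hA (w - w'))).1
      have h3 : inner ℝ fL ((w - w' : EL.domain) : K) ≤ ‖fL‖ * EL.domNorm (w - w') :=
        (real_inner_le_norm _ _).trans
          (mul_le_mul_of_nonneg_left (EL.norm_le_domNorm _) (norm_nonneg _))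
      have h4 : shiftedForm EL.form α (w - w') ⟨vL, hvL⟩ =
          shiftedForm EL.form α w ⟨vL, hvL⟩ - shiftedForm EL.form α w' ⟨vL, hvL⟩ := by
        simp only [shiftedForm, map_sub, LinearMap.sub_apply, Submodule.coe_sub, inner_sub_left]
        ring
      rw [h4] at h2
      rw [Submodule.coe_sub, inner_sub_right] at h3
      have h5 : (A + ‖fL‖ + 1) * EL.domNorm (w - w') < ε := by
        rwa [lt_div_iff₀' (by positivity)] at hw'
      nlinarith [EL.domNorm_nonneg (w - w')]
    refine EL.eq_flip_resolvent hα fL ⟨vL, hvL⟩ fun w => le_antisymm ?_ (hpos' w)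
    have h1 := hpos' (-w)
    have h2 : shiftedForm EL.form α (-w) ⟨vL, hvL⟩ = - shiftedForm EL.form α w ⟨vL, hvL⟩ := by
      simp only [shiftedForm, map_neg, LinearMap.neg_apply, Submodule.coe_neg, inner_neg_left]
      ring
    rw [h2, Submodule.coe_neg, inner_neg_right] at h1
    linarith
  -- Every subsequence has a further subsequence with the limit just identified, so the whole
  -- sequence converges.
  refine ⟨⟨_, Eventually.of_forall hvB⟩, fun φ => tendsto_of_subseq_tendsto fun ns hns => ?_⟩
  obtain ⟨m, -, hm⟩ := strictMono_subseq_of_tendsto_atTop hns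
  obtain ⟨k, vL, hk, hw⟩ := (hP.comp hm.tendsto_atTop).exists_weakConv_subseq
    (f := fun i => v ((ns ∘ m) i)) (fun i => hvB _)
  refine ⟨fun i => m (k i), ?_⟩
  have := key (fun i => ns (m (k i))) vL (hm.comp hk) hw
  rw [← this]
  exact hw.2 φ

/-- The Mosco-type conditions imply strong resolvent convergence. -/
theorem strongConv_resolvent (hP : AsymptoticIsometry atTop P Q)
    (hF1 : ∀ (f : ∀ n, H n) (fL : K), WeakConv atTop P Q f fL →
      liminf (fun n => (E n).dualNorm (f n)) atTop < ∞ → fL ∈ EL.domain)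
    (hF2 : ∀ n : ℕ → ℕ, StrictMono n → ∀ (f : ∀ k, (E (n k)).domain) (fL : EL.domain),
      WeakConv atTop (fun k => P (n k)) Q (fun k => (f k : H (n k))) (fL : K) →
      (⨆ k, (E (n k)).dualNorm (f k)) < ∞ →
      ∃ C : Set EL.domain, (∀ v, ∀ ε > 0, ∃ w ∈ C, EL.domNorm (v - w) < ε) ∧
        ∀ w ∈ C, ∃ u : ∀ k, (E (n k)).domain,
          StrongConv atTop (fun k => P (n k)) Q (fun k => (u k : H (n k))) (w : K) ∧
          liminf (fun k => (((E (n k)).form (u k) (f k) : ℝ) : EReal)) atTop ≤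
            ((EL.form w fL : ℝ) : EReal))
    {α : ℝ} (hα : 0 < α) {f : ∀ n, H n} {fL : K} (hf : StrongConv atTop P Q f fL) :
    StrongConv atTop P Q (fun n => (E n).resolvent α (f n)) (EL.resolvent α fL) := by
  refine strongConv_of_tendsto_inner hP ⟨α⁻¹ * (‖fL‖ + 1), ?_⟩ fun g gL hg => ?_
  · filter_upwards [hf.eventually_norm_le] with n hn
    exact ((E n).norm_resolvent_le hα _).trans (by gcongr)
  · have h1 := hf.tendsto_inner (weakConv_flip_resolvent hP hF1 hF2 hα hg) hP
    rw [← EL.inner_resolvent_left hα, real_inner_comm] at h1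
    refine h1.congr fun n => ?_
    rw [← (E n).inner_resolvent_left hα, real_inner_comm]

end Converse

/-- Powers of the Yosida approximation are polynomials in $G_\alpha$, and strong convergence is
linear. -/
theorem strongConv_yosida_pow (hP : AsymptoticIsometry atTop P Q)
    (hR : ∀ (f : ∀ n, H n) (fL : K), StrongConv atTop P Q f fL → ∀ α : ℝ, 0 < α →
      StrongConv atTop P Q (fun n => (E n).resolvent α (f n)) (EL.resolvent α fL))
    {α : ℝ} (hα : 0 < α) {u : ∀ n, H n} {u' : K} (hu : StrongConv atTop P Q u u') (m : ℕ) :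
    StrongConv atTop P Q (fun n => ((E n).yosida α ^ m) (u n)) ((EL.yosida α ^ m) u') := by
  induction m with
  | zero => simpa using hu
  | succ m ih =>
    simp only [pow_succ']
    exact (((hR _ _ ih α hα).const_smul α hP).sub ih hP).const_smul α hP

section Semigroups
variable [∀ n, CompleteSpace (H n)] [CompleteSpace K]

/-- Strong convergence of semigroups implies strong convergence of resolvents. -/
theorem strongConv_resolvent_of_semigroup (hP : AsymptoticIsometry atTop P Q)
    {f : ∀ n, H n} {fL : K} (hf : StrongConv atTop P Q f fL)
    (hS : ∀ t, 0 ≤ t →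
      StrongConv atTop P Q (fun n => (E n).semigroup t (f n)) (EL.semigroup t fL))
    {α : ℝ} (hα : 0 < α) :
    StrongConv atTop P Q (fun n => (E n).resolvent α (f n)) (EL.resolvent α fL) := by
  have hfb := hf.eventually_norm_le
  have key : ∀ (g : ∀ n, H n) (gL : K), WeakConv atTop P Q g gL →
      Tendsto (fun n => inner ℝ (g n) ((E n).resolvent α (f n))) atTop
        (𝓝 (inner ℝ gL (EL.resolvent α fL))) := by
    intro g gL hg
    obtain ⟨C, hC⟩ := hg.1
    -- Dominated convergence in the Laplace integral, with a multiple of $e^{-\alpha t}$ as the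
    -- bound.
    simp only [CoerciveClosedForm.inner_resolvent_eq_integral _ hα]
    refine tendsto_integral_filter_of_dominated_convergence
      (fun t => Real.exp (-α * t) * (|C| * (‖fL‖ + 1))) (Eventually.of_forall fun n => ?_) ?_
      ((integrableOn_exp_mul_Ioi (neg_neg_of_pos hα) 0).mul_const _) ?_
    · have := ((E n).aestronglyMeasurable_exp_smul_semigroup α (f n)).inner_const
        (𝕜 := ℝ) (c := g n)
      simpa only [inner_smul_right, real_inner_comm] using this
    · filter_upwards [hC, hfb] with n h1 h2
      refine (ae_restrict_iff' measurableSet_Ioi).2 (Eventually.of_forall fun t ht => ?_)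
      rw [norm_mul, Real.norm_of_nonneg (Real.exp_pos _).le, Real.norm_eq_abs]
      gcongr
      exact (abs_real_inner_le_norm _ _).trans (mul_le_mul (h1.trans (le_abs_self C))
        (((E n).norm_semigroup_le (le_of_lt ht) _).trans h2) (norm_nonneg _) (abs_nonneg _))
    · refine (ae_restrict_iff' measurableSet_Ioi).2 (Eventually.of_forall fun t ht => ?_)
      have := (hS t (le_of_lt ht)).tendsto_inner hg hP
      simpa only [real_inner_comm] using this.const_mul (Real.exp (-α * t))
  refine strongConv_of_tendsto_inner hP ⟨α⁻¹ * (‖fL‖ + 1), ?_⟩ key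
  filter_upwards [hfb] with n hn
  exact ((E n).norm_resolvent_le hα _).trans (by gcongr)

/-- Strong convergence of resolvents implies strong convergence of semigroups, locally uniformly in
time. -/
theorem strongConv_semigroup (hP : AsymptoticIsometry atTop P Q)
    (hR : ∀ (f : ∀ n, H n) (fL : K), StrongConv atTop P Q f fL → ∀ α : ℝ, 0 < α →
      StrongConv atTop P Q (fun n => (E n).resolvent α (f n)) (EL.resolvent α fL))
    {f : ∀ n, H n} {fL : K} (hf : StrongConv atTop P Q f fL) {T s : ℝ} (hs : s ∈ Set.Icc 0 T) :
    StrongConv (atTop ×ˢ 𝓝[Set.Icc 0 T] s) (fun i : ℕ × ℝ => P i.1) Q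
      (fun i => (E i.1).semigroup i.2 (f i.1)) (EL.semigroup s fL) := by
  refine strongConv_of_approx fun ε hε => ?_
  -- Half of `ε` pays for replacing the vector by $G_1G_1h$, the other half for the Yosida
  -- approximation. Both estimates are uniform in the form and in the time.
  obtain ⟨h', hh'⟩ := EL.exists_resolvent_resolvent_near fL (half_pos hε)
  obtain ⟨h, hh⟩ := hP.exists_strongConv h'
  set u : ∀ n, H n := fun n => (E n).resolvent 1 ((E n).resolvent 1 (h n)) with hu_def
  set u' := EL.resolvent 1 (EL.resolvent 1 h') with hu'_def
  have hu : StrongConv atTop P Q u u' := hR _ _ (hR _ _ hh 1 one_pos) 1 one_pos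
  have hT : 0 ≤ T := hs.1.trans hs.2
  -- The value makes $4(\|h'\|+1)(T+1)/\alpha=\varepsilon/2$. The norms of the `h n` are only
  -- eventually below `‖h'‖ + 1`, and `T + 1` keeps `α` positive when `T = 0`.
  set α := 8 * (‖h'‖ + 1) * (T + 1) / ε with hα_def
  have hα : 0 < α := by positivity
  have hest : ∀ b t : ℝ, 0 ≤ b → b ≤ ‖h'‖ + 1 → t ∈ Set.Icc 0 T → 4 * b / α * t ≤ ε / 2 := by
    intro b t hb0 hb ht
    have h1 : 4 * b / α * t ≤ 4 * (‖h'‖ + 1) / α * (T + 1) := by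
      have := ht.2
      have := ht.1
      gcongr
      linarith
    refine h1.trans (le_of_eq ?_)
    rw [hα_def]; field_simp; ring
  have hfst : Tendsto (Prod.fst : ℕ × ℝ → ℕ) (atTop ×ˢ 𝓝[Set.Icc 0 T] s) atTop := tendsto_fst
  have hsnd : Tendsto (Prod.snd : ℕ × ℝ → ℝ) (atTop ×ˢ 𝓝[Set.Icc 0 T] s) (𝓝[Set.Icc 0 T] s) :=
    tendsto_snd
  have hmem : ∀ᶠ i : ℕ × ℝ in atTop ×ˢ 𝓝[Set.Icc 0 T] s, i.2 ∈ Set.Icc 0 T :=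
    hsnd.eventually self_mem_nhdsWithin
  refine ⟨fun i => NormedSpace.exp (i.2 • (E i.1).yosida α) (u i.1),
    NormedSpace.exp (s • EL.yosida α) u',
    strongConv_exp (hP.comp hfst) (R := T) (M := 2 * α) (by positivity)
      (hsnd.mono_right nhdsWithin_le_nhds)
      (hmem.mono fun i hi => by rw [abs_of_nonneg hi.1]; exact hi.2)
      (fun i => (E i.1).norm_yosida_le hα)
      fun m => (strongConv_yosida_pow hP hR hα hu m).comp hfst, ?_, ?_⟩
  · have h1 := EL.norm_semigroup_sub_exp_yosida_le hα hs.1 h'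
    have h2 := EL.norm_semigroup_le hs.1 (fL - u')
    rw [map_sub] at h2
    have h3 := hest ‖h'‖ s (norm_nonneg _) (by linarith) hs
    calc _ ≤ ‖EL.semigroup s fL - EL.semigroup s u'‖ +
          ‖EL.semigroup s u' - NormedSpace.exp (s • EL.yosida α) u'‖ :=
          norm_sub_le_norm_sub_add_norm_sub _ _ _
      _ ≤ ε := by linarith
  · filter_upwards [hmem, hfst.eventually hh.eventually_norm_le, hfst.eventually
      ((hf.sub hu hP).tendsto_norm.eventually (gt_mem_nhds hh'))] with i hi h4 h5
    have h1 := (E i.1).norm_semigroup_sub_exp_yosida_le hα hi.1 (h i.1)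
    have h2 := (E i.1).norm_semigroup_le hi.1 (f i.1 - u i.1)
    rw [map_sub] at h2
    have h3 := hest ‖h i.1‖ i.2 (norm_nonneg _) h4 hi
    calc _ ≤ ‖(E i.1).semigroup i.2 (f i.1) - (E i.1).semigroup i.2 (u i.1)‖ +
          ‖(E i.1).semigroup i.2 (u i.1) - NormedSpace.exp (i.2 • (E i.1).yosida α) (u i.1)‖ :=
          norm_sub_le_norm_sub_add_norm_sub _ _ _
      _ ≤ ε := by linarith

end Semigroups
end VaryingForms

/-! ### Test functions as vectors of the spaces $L^2$ -/

section TestFunctions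
variable {Z : Type*} [MetricSpace Z]

theorem IsCbs.add {φ ψ : Z → ℝ} (hφ : IsCbs φ) (hψ : IsCbs ψ) : IsCbs (φ + ψ) := by
  obtain ⟨h1, ⟨C, hC⟩, h2⟩ := hφ
  obtain ⟨h1', ⟨C', hC'⟩, h2'⟩ := hψ
  exact ⟨h1.add h1', ⟨C + C', fun z => (abs_add_le _ _).trans (add_le_add (hC z) (hC' z))⟩,
    (h2.union h2').subset (Function.support_add _ _)⟩

/-- A bounded continuous function times a function in `C_bs(Z)` is in `C_bs(Z)`. -/
theorem IsCbs.bounded_mul {φ ψ : Z → ℝ} (hφ : Continuous φ) {C : ℝ} (hC : ∀ z, |φ z| ≤ C)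
    (hψ : IsCbs ψ) : IsCbs (φ * ψ) := by
  obtain ⟨h1', ⟨C', hC'⟩, h2'⟩ := hψ
  refine ⟨hφ.mul h1', ⟨C * C', fun z => ?_⟩, h2'.subset (Function.support_mul_subset_right _ _)⟩
  rw [Pi.mul_apply, abs_mul]
  exact mul_le_mul (hC z) (hC' z) (abs_nonneg _) ((abs_nonneg _).trans (hC z))

variable (Z) in
/-- The space `C_bs(Z)`. -/
def cbsSubmodule : Submodule ℝ (Z → ℝ) where
  carrier := {φ | IsCbs φ}
  add_mem' := IsCbs.add
  zero_mem' := ⟨continuous_zero, ⟨0, fun z => by simp⟩, by simp⟩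
  smul_mem' c _ hφ := IsCbs.bounded_mul (φ := fun _ => c) continuous_const (fun _ => le_rfl) hφ

/-- The truncated distance `z ↦ max 0 (min 1 (R - d(z, z₀)))` is in `C_bs(Z)`. -/
theorem isCbs_cutoff (z₀ : Z) (R : ℝ) : IsCbs fun z => max 0 (min 1 (R - dist z z₀)) := by
  refine ⟨by fun_prop, ⟨1, fun z => ?_⟩,
    (Metric.isBounded_ball (x := z₀) (r := R)).subset fun z hz => ?_⟩
  · rw [abs_of_nonneg (le_max_left _ _)]
    exact max_le zero_le_one (min_le_left _ _)
  · by_contra hlt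
    refine hz (max_eq_left ((min_le_right _ _).trans ?_))
    rw [Metric.mem_ball] at hlt
    linarith

/-- The support pulls back to a bounded set under an isometry, and bounded sets have finite measure.
-/
theorem IsCbs.memLp {X : PMMSpace} {j : X → Z} (hj : Isometry j) {φ : Z → ℝ} (hφ : IsCbs φ) :
    MemLp (fun x => φ (j x)) 2 X.measure := by
  obtain ⟨h1, ⟨C, hC⟩, h2⟩ := hφ
  have hcont : Continuous fun x => φ (j x) := h1.comp hj.continuous
  have hs : MeasurableSet (Function.support fun x => φ (j x)) := hcont.isOpen_support.measurableSet
  have hb : Bornology.IsBounded (Function.support fun x => φ (j x)) :=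
    hj.antilipschitz.isBounded_preimage h2
  refine (memLp_indicator_const 2 hs C (Or.inr (X.measure_lt_top _ hb).ne)).mono'
    hcont.aestronglyMeasurable (Eventually.of_forall fun x => ?_)
  by_cases hx : x ∈ Function.support fun x => φ (j x)
  · rw [Set.indicator_of_mem hx]; exact hC _
  · rw [Set.indicator_of_notMem hx, Function.notMem_support.1 hx, norm_zero]

/-- The map `φ ↦ φ ∘ j` from `C_bs(Z)` to `L²(X, m)`. -/
noncomputable def testMap {X : PMMSpace} {j : X → Z} (hj : Isometry j) :
    cbsSubmodule Z →ₗ[ℝ] X.L2 where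
  toFun φ := (IsCbs.memLp hj φ.2).toLp _
  map_add' _ _ := rfl
  map_smul' _ _ := rfl

variable {X : PMMSpace} {j : X → Z} (hj : Isometry j)

theorem coeFn_testMap (φ : cbsSubmodule Z) :
    testMap hj φ =ᵐ[X.measure] fun x => (φ : Z → ℝ) (j x) :=
  MemLp.coeFn_toLp (IsCbs.memLp hj φ.2)

theorem inner_testMap (φ : cbsSubmodule Z) (f : X.L2) :
    inner ℝ (testMap hj φ) f = ∫ x, (φ : Z → ℝ) (j x) * f x ∂X.measure := by
  rw [L2.inner_def]
  refine integral_congr_ae ?_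
  filter_upwards [coeFn_testMap hj φ] with x hx
  rw [hx]
  exact mul_comm _ _

theorem inner_testMap_testMap (φ ψ : cbsSubmodule Z) :
    inner ℝ (testMap hj φ) (testMap hj ψ) =
      ∫ x, ((φ : Z → ℝ) * (ψ : Z → ℝ)) (j x) ∂X.measure := by
  rw [inner_testMap]
  refine integral_congr_ae ?_
  filter_upwards [coeFn_testMap hj ψ] with x hx
  rw [hx]
  rfl

/-- A vector orthogonal to `C_bs(Z)` is orthogonal to all bounded continuous functions in `L²`. -/
theorem integral_mul_eq_zero_of_orthogonal (f : X.L2) (hf : ∀ φ, inner ℝ (testMap hj φ) f = 0)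
    (g : BoundedContinuousFunction Z ℝ) (hg : MemLp (fun x => g (j x)) 2 X.measure) :
    ∫ x, g (j x) * f x ∂X.measure = 0 := by
  have hχ := fun n : ℕ => isCbs_cutoff (j X.base) (n : ℝ)
  have hint : Integrable (fun x => g (j x) * f x) X.measure := hg.integrable_mul (Lp.memLp f)
  -- Multiplying by cut-offs gives elements of $C_{bs}(Z)$. At each point the cut-off equals $1$ as
  -- soon as $n\ge 1+d$, and $|gf|$ dominates.
  have hlim : Tendsto (fun n : ℕ => ∫ x, (g (j x) * max 0 (min 1 (n - dist (j x) (j X.base)))) * f x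
      ∂X.measure) atTop (𝓝 (∫ x, g (j x) * f x ∂X.measure)) := by
    refine tendsto_integral_of_dominated_convergence (fun x => ‖g (j x) * f x‖) (fun n => ?_)
      hint.norm (fun n => Eventually.of_forall fun x => ?_) (Eventually.of_forall fun x => ?_)
    · exact (((g.continuous.mul (hχ n).1).comp hj.continuous).aestronglyMeasurable).mul
        (Lp.aestronglyMeasurable f)
    · rw [mul_right_comm, norm_mul]
      refine mul_le_of_le_one_right (norm_nonneg _) ?_
      rw [Real.norm_of_nonneg (le_max_left _ _)]
      exact max_le zero_le_one (min_le_left _ _)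
    · refine tendsto_nhds_of_eventually_eq ?_
      obtain ⟨N, hN⟩ := exists_nat_ge (1 + dist (j x) (j X.base))
      filter_upwards [eventually_ge_atTop N] with n hn
      have : (N : ℝ) ≤ n := by exact_mod_cast hn
      rw [min_eq_left (by linarith), max_eq_right zero_le_one, mul_one]
  refine tendsto_nhds_unique hlim (tendsto_const_nhds.congr fun n => ?_)
  have := hf ⟨_, IsCbs.bounded_mul g.continuous (fun z => g.norm_coe_le_norm z) (hχ n)⟩
  rw [inner_testMap] at this
  exact this.symm

/-- Bounded continuous functions are dense in $L^2$ of the push-forward measure on $Z$. For $f\ne0$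
orthogonal to all test functions, such a $g$ within $\|f\|/2$ of $f$ is also orthogonal to $f$, so
$\|f\|^2=(f-g,f)\le\|f\|^2/2$, a contradiction. -/
theorem denseRange_testMap [TopologicalSpace.SeparableSpace Z] : DenseRange (testMap hj) := by
  have h : (LinearMap.range (testMap hj)).topologicalClosure = ⊤ := by
    rw [Submodule.topologicalClosure_eq_top_iff, eq_bot_iff]
    intro f hf
    have hf0 : ∀ φ, inner ℝ (testMap hj φ) f = 0 := fun φ =>
      (Submodule.mem_orthogonal _ _).1 hf _ ⟨φ, rfl⟩
    have : SecondCountableTopology Z := UniformSpace.secondCountable_of_separable Z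
    borelize Z
    have hemb : MeasurableEmbedding j := hj.isClosedEmbedding.measurableEmbedding
    set μ := X.measure.map j with hμ
    have : IsLocallyFiniteMeasure μ := ⟨fun z => ⟨Metric.ball z 1, Metric.ball_mem_nhds z one_pos, by
      rw [hμ, hemb.map_apply]
      exact X.measure_lt_top _ (hj.antilipschitz.isBounded_preimage Metric.isBounded_ball)⟩⟩
    -- The vector is carried to $Z$ by the value $0$ off the image of the closed embedding.
    have hext : (Function.extend j f 0) ∘ j = f := Function.extend_comp hj.injective _ _
    have hmem : MemLp (Function.extend j f 0) 2 μ := by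
      rw [hμ, hemb.memLp_map_measure_iff, hext]
      exact Lp.memLp f
    by_contra hne
    have hpos : 0 < ‖f‖ := norm_pos_iff.2 hne
    obtain ⟨g, hg, hgm⟩ := hmem.exists_boundedContinuous_eLpNorm_sub_le (by norm_num)
      (ε := ENNReal.ofReal (‖f‖ / 2)) (by simpa using hpos)
    have hgj : MemLp (fun x => g (j x)) 2 X.measure := by
      rw [hμ, hemb.memLp_map_measure_iff] at hgm
      exact hgm
    have hsub : ‖f - hgj.toLp _‖ ≤ ‖f‖ / 2 := by
      rw [Lp.norm_def]
      refine ENNReal.toReal_le_of_le_ofReal (by positivity) ?_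
      have h1 : eLpNorm (⇑(f - hgj.toLp _)) 2 X.measure =
          eLpNorm (Function.extend j f 0 - (g : Z → ℝ)) 2 μ := by
        rw [hμ, hemb.eLpNorm_map_measure]
        refine eLpNorm_congr_ae ?_
        filter_upwards [Lp.coeFn_sub f (hgj.toLp _), hgj.coeFn_toLp] with x hx1 hx2
        rw [hx1, Pi.sub_apply, hx2, Function.comp_apply, Pi.sub_apply, hj.injective.extend_apply]
      rw [h1]; exact hg
    have h0 : inner ℝ (hgj.toLp _) f = 0 := by
      rw [L2.inner_def, ← integral_mul_eq_zero_of_orthogonal hj f hf0 g hgj]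
      refine integral_congr_ae ?_
      filter_upwards [hgj.coeFn_toLp] with x hx
      rw [hx]
      exact mul_comm _ _
    have h1 : inner ℝ (f - hgj.toLp _) f = ‖f‖ ^ 2 := by
      rw [inner_sub_left, h0, sub_zero, real_inner_self_eq_norm_sq]
    have h2 := real_inner_le_norm (f - hgj.toLp _) f
    nlinarith
  have h2 := Submodule.dense_iff_topologicalClosure_eq_top.2 h
  rwa [DenseRange, ← LinearMap.coe_range]

theorem PMMSpace.separableSpace_L2 (X : PMMSpace) : TopologicalSpace.SeparableSpace X.L2 := by
  have : SecondCountableTopology X := UniformSpace.secondCountable_of_separable X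
  have : IsLocallyFiniteMeasure X.measure := ⟨fun x => ⟨Metric.ball x 1,
    Metric.ball_mem_nhds x one_pos, X.measure_lt_top _ Metric.isBounded_ball⟩⟩
  have : Fact ((2 : ℝ≥0∞) ≠ ∞) := ⟨by norm_num⟩
  infer_instance

end TestFunctions

/-! ### From convergence in $Z$ to the Hilbert space setting -/

section Translation
variable {Z : Type*} [MetricSpace Z]

/-- The inner product of two test vectors is the integral of their product, again a function in
$C_{bs}(Z)$, to which the convergence of measures applies. -/
theorem RealizesPmG.asymptoticIsometry [TopologicalSpace.SeparableSpace Z] {X : ℕ∞ → PMMSpace}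
    {ι : ∀ n, X n → Z} (hι : RealizesPmG X ι) :
    AsymptoticIsometry atTop (fun n : ℕ => testMap (hι.isometry n)) (testMap (hι.isometry ⊤)) where
  denseRange := denseRange_testMap _
  tendsto_inner φ ψ := by
    simp only [inner_testMap_testMap]
    obtain ⟨C, hC⟩ := φ.2.2.1
    exact hι.tendsto_integral _ (IsCbs.bounded_mul φ.2.1 hC ψ.2)

variable {Y : ℕ → PMMSpace} {YL : PMMSpace} {j : ∀ k, Y k → Z} {jL : YL → Z}
  (hj : ∀ k, Isometry (j k)) (hjL : Isometry jL) {f : ∀ k, (Y k).L2} {fL : YL.L2}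

theorem weakL2_iff : WeakL2 j jL f fL ↔
    WeakConv atTop (fun k => testMap (hj k)) (testMap hjL) f fL := by
  constructor
  · rintro ⟨⟨C, hC⟩, h⟩
    refine ⟨⟨C, Eventually.of_forall hC⟩, fun φ => ?_⟩
    simp only [inner_testMap]
    exact h φ φ.2
  · rintro ⟨hC, h⟩
    refine ⟨exists_norm_le_of_eventually hC, fun φ hφ => ?_⟩
    have := h ⟨φ, hφ⟩
    simpa only [inner_testMap] using this

/-- Weak lower semicontinuity supplies the lower bound for the norms, so the condition on the upper
limit amounts to convergence of norms. -/
theorem strongL2_iff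
    (hP : AsymptoticIsometry atTop (fun k => testMap (hj k)) (testMap hjL)) :
    StrongL2 j jL f fL ↔ StrongConv atTop (fun k => testMap (hj k)) (testMap hjL) f fL := by
  rw [StrongL2, weakL2_iff hj hjL]
  constructor
  · rintro ⟨hw, hlim⟩
    refine hw.strongConv_of_eventually_lt hP fun a ha => ?_
    -- Boundedness makes the real upper limit meaningful.
    obtain ⟨C, hC⟩ := hw.1
    refine eventually_lt_of_limsup_lt (hlim.trans_lt ha)
      (isBoundedUnder_of_eventually_le (a := C ^ 2) ?_)
    filter_upwards [hC] with k hk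
    gcongr
  · exact fun h => ⟨h.weakConv hP, (h.tendsto_norm.pow 2).limsup_eq.le⟩

end Translation

/-! ### Assembling the equivalences -/

section Main
variable {Z : Type*} [MetricSpace Z] {X : ℕ∞ → PMMSpace} {ι : ∀ n, X n → Z}
  {E : ∀ n, CoerciveClosedForm (X n).L2}

theorem RealizesPmG.weakL2_iff (hι : RealizesPmG X ι) (n : ℕ → ℕ) {f : ∀ k, (X (n k)).L2}
    {fL : (X ⊤).L2} : WeakL2 (fun k => ι (n k)) (ι ⊤) f fL ↔
      WeakConv atTop (fun k => testMap (hι.isometry (n k))) (testMap (hι.isometry ⊤)) f fL :=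
  _root_.weakL2_iff _ _

/-- A smaller functional admits more sequences and so gives a stronger condition. This and its
counterpart for `CondF2Prime` reduce part (ii) to part (i). -/
theorem CondF1.mono {N N' : ∀ n, (X n).L2 → ℝ≥0∞} (hN : ∀ n f, N n f ≤ N' n f)
    (h : CondF1 ι E N) : CondF1 ι E N' := fun f fL hf hlim =>
  h f fL hf ((liminf_le_liminf (Eventually.of_forall fun _ => hN _ _)).trans_lt hlim)

theorem CondF2Prime.mono {N N' : ∀ n, (X n).L2 → ℝ≥0∞} (hN : ∀ n f, N n f ≤ N' n f)
    (h : CondF2Prime ι E N) : CondF2Prime ι E N' := fun n hn f fL hf hsup =>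
  h n hn f fL hf ((iSup_mono fun _ => hN _ _).trans_lt hsup)

variable [TopologicalSpace.SeparableSpace Z]

theorem RealizesPmG.strongL2_iff (hι : RealizesPmG X ι) {n : ℕ → ℕ} (hn : Tendsto n atTop atTop)
    {f : ∀ k, (X (n k)).L2} {fL : (X ⊤).L2} : StrongL2 (fun k => ι (n k)) (ι ⊤) f fL ↔
      StrongConv atTop (fun k => testMap (hι.isometry (n k))) (testMap (hι.isometry ⊤)) f fL :=
  _root_.strongL2_iff _ _ (hι.asymptoticIsometry.comp hn)

theorem CondF2.condF2Prime (hι : RealizesPmG X ι) (h : CondF2 ι E) (N : ∀ n, (X n).L2 → ℝ≥0∞) :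
    CondF2Prime ι E N := by
  intro n hn f fL hf _
  -- `CondF2` speaks of full sequences, so the subsequence is extended, recovered and restricted
  -- again. The dense set can then be the whole domain.
  obtain ⟨g, hg, hgw⟩ := exists_weakConv_extend_domain (E := fun n : ℕ => E n)
    hι.asymptoticIsometry hn f ((hι.weakL2_iff n).1 hf)
  refine ⟨Set.univ, fun v ε hε => ⟨v, trivial, ?_⟩, fun w _ => ?_⟩
  · have := (E ⊤).domNorm_smul 0 v
    rw [zero_smul, abs_zero, zero_mul] at this
    rwa [sub_self, this]
  · obtain ⟨u, hu, hlim⟩ := h g fL w ((hι.weakL2_iff id).2 hgw)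
    refine ⟨fun k => u (n k), (hι.strongL2_iff hn.tendsto_atTop).2
      (((hι.strongL2_iff tendsto_id).1 hu).comp hn.tendsto_atTop), ?_⟩
    have h1 := (continuous_coe_real_ereal.tendsto _).comp (hlim.comp hn.tendsto_atTop)
    simp only [Function.comp_def, hg] at h1
    exact h1.liminf_eq.le

theorem resolventConv_of_cond (hι : RealizesPmG X ι) (h1 : CondF1 ι E fun n => (E n).dualNorm)
    (h2 : CondF2Prime ι E fun n => (E n).dualNorm) : ResolventConv ι E := by
  intro f fL hf α hα
  have := (X ⊤).separableSpace_L2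
  refine (hι.strongL2_iff tendsto_id).2 (strongConv_resolvent (E := fun n : ℕ => E n)
    hι.asymptoticIsometry (fun f fL hw => h1 f fL ((hι.weakL2_iff id).2 hw)) ?_ hα
    ((hι.strongL2_iff tendsto_id).1 hf))
  intro n hn f fL hw hsup
  obtain ⟨C, hC, hCw⟩ := h2 n hn f fL ((hι.weakL2_iff n).2 hw) hsup
  refine ⟨C, hC, fun w hwC => ?_⟩
  obtain ⟨u, hu, hlim⟩ := hCw w hwC
  exact ⟨u, (hι.strongL2_iff hn.tendsto_atTop).1 hu, hlim⟩

theorem ResolventConv.strongConv (hι : RealizesPmG X ι) (h : ResolventConv ι E)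
    (f : ∀ n : ℕ, (X n).L2) (fL : (X ⊤).L2)
    (hf : StrongConv atTop (fun n : ℕ => testMap (hι.isometry n)) (testMap (hι.isometry ⊤)) f fL)
    (α : ℝ) (hα : 0 < α) :
    StrongConv atTop (fun n : ℕ => testMap (hι.isometry n)) (testMap (hι.isometry ⊤))
      (fun n => (E n).resolvent α (f n)) ((E ⊤).resolvent α fL) :=
  (hι.strongL2_iff tendsto_id).1 (h f fL ((hι.strongL2_iff tendsto_id).2 hf) α hα)

theorem ResolventConv.condF1 (hι : RealizesPmG X ι) (h : ResolventConv ι E) :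
    CondF1 ι E fun n => (E n).dualNorm := fun _ _ hf hlim =>
  mem_domain_of_resolventConv (E := fun n : ℕ => E n) hι.asymptoticIsometry
    (fun f fL hf => h.strongConv hι f fL hf 1 one_pos) ((hι.weakL2_iff id).1 hf) hlim

theorem ResolventConv.condF2 (hι : RealizesPmG X ι) (h : ResolventConv ι E) : CondF2 ι E := by
  intro f fL wL hf
  obtain ⟨w, hw, hlim⟩ := exists_recovery_of_resolventConv (E := fun n : ℕ => E n)
    hι.asymptoticIsometry (fun f fL hf => h.strongConv hι f fL hf 1 one_pos) f fL wL
    ((hι.weakL2_iff id).1 hf)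
  exact ⟨w, (hι.strongL2_iff tendsto_id).2 hw, hlim⟩

theorem SemigroupConv.resolventConv (hι : RealizesPmG X ι) (h : SemigroupConv ι E) :
    ResolventConv ι E := fun f fL hf _ hα =>
  (hι.strongL2_iff tendsto_id).2 (strongConv_resolvent_of_semigroup (E := fun n : ℕ => E n)
    hι.asymptoticIsometry ((hι.strongL2_iff tendsto_id).1 hf)
    (fun t ht => (hι.strongL2_iff tendsto_id).1 ((h f fL hf).1 t ht)) hα)

/-- Uniform convergence on a compact set from convergence along moving arguments. -/
theorem tendstoUniformlyOn_of_forall_tendsto {F : ℕ → ℝ → ℝ} {G : ℝ → ℝ} {S : Set ℝ}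
    (hS : IsCompact S) (hG : ContinuousOn G S)
    (h : ∀ s ∈ S, Tendsto (fun i : ℕ × ℝ => F i.1 i.2) (atTop ×ˢ 𝓝[S] s) (𝓝 (G s))) :
    TendstoUniformlyOn F G atTop S := by
  -- On a compact set locally uniform convergence suffices. Near `s`, both `F n t` and, by
  -- continuity, `G t` are close to `G s`.
  rw [← tendstoLocallyUniformlyOn_iff_tendstoUniformlyOn_of_compact hS,
    tendstoLocallyUniformlyOn_iff_forall_tendsto]
  intro s hs
  exact (((hG s hs).tendsto.comp (tendsto_snd (f := (atTop : Filter ℕ)))).prodMk_nhds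
    (h s hs)).mono_right (nhds_le_uniformity _)

theorem ResolventConv.semigroupConv (hι : RealizesPmG X ι) (h : ResolventConv ι E) :
    SemigroupConv ι E := by
  intro f fL hf
  have hP := hι.asymptoticIsometry
  have hf' := (hι.strongL2_iff tendsto_id).1 hf
  obtain ⟨B, hB⟩ := hf.1.1
  have hbound : ∀ (n : ℕ) (t : ℝ), 0 ≤ t → ‖(E n).semigroup t (f n)‖ ≤ B := fun n t ht =>
    ((E n).norm_semigroup_le ht _).trans (hB n)
  have key := fun (T s : ℝ) (hs : s ∈ Set.Icc 0 T) =>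
    strongConv_semigroup (E := fun n : ℕ => E n) hP (h.strongConv hι) hf' hs
  have hcont : ∀ T : ℝ, ContinuousOn (fun t => (E ⊤).semigroup t fL) (Set.Icc 0 T) := fun T =>
    ((E ⊤).continuousOn_semigroup fL).mono Set.Icc_subset_Ici_self
  refine ⟨fun t ht => (hι.strongL2_iff tendsto_id).2 ?_, fun T hT => ⟨⟨B, fun n t ht =>
    hbound n t ht.1⟩, fun φ hφ => tendstoUniformlyOn_of_forall_tendsto isCompact_Icc ?_ ?_,
    tendstoUniformlyOn_of_forall_tendsto isCompact_Icc (hcont T).norm fun s hs =>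
      (key T s hs).tendsto_norm⟩⟩
  -- Freezing the time in the joint limit gives convergence at the single time `t`.
  · exact (key t t ⟨ht, le_rfl⟩).comp (n := fun n : ℕ => (n, t))
      (tendsto_id.prodMk (tendsto_const_nhdsWithin ⟨ht, le_rfl⟩))
  · have := ContinuousOn.inner (𝕜 := ℝ)
      (continuousOn_const (c := testMap (hι.isometry ⊤) ⟨φ, hφ⟩)) (hcont T)
    simpa only [inner_testMap] using this
  · intro s hs
    have := ((key T s hs).weakConv (hP.comp tendsto_fst)).2 ⟨φ, hφ⟩
    simpa only [inner_testMap] using this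

end Main

theorem mainTheorem7 {Z : Type*} [MetricSpace Z] [CompleteSpace Z]
    [TopologicalSpace.SeparableSpace Z] (X : ℕ∞ → PMMSpace) (ι : ∀ n, X n → Z)
    (hι : RealizesPmG X ι) (E : ∀ n, CoerciveClosedForm (X n).L2) :
    ((CondF1 ι E (fun n => (E n).dualNorm) ∧ CondF2 ι E ↔
        CondF1 ι E (fun n => (E n).dualNorm) ∧ CondF2Prime ι E (fun n => (E n).dualNorm)) ∧
      (CondF1 ι E (fun n => (E n).dualNorm) ∧ CondF2Prime ι E (fun n => (E n).dualNorm) ↔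
        ResolventConv ι E) ∧
      (ResolventConv ι E ↔ SemigroupConv ι E)) ∧
    (CondF1 ι E (fun n => (E n).energyNorm) ∧ CondF2Prime ι E (fun n => (E n).energyNorm) →
      ResolventConv ι E) := by
  have hle : ∀ n f, (E n).energyNorm f ≤ (E n).dualNorm f := fun n f =>
    (E n).energyNorm_le_dualNorm f
  refine ⟨⟨⟨fun h => ⟨h.1, h.2.condF2Prime hι _⟩, fun h => ⟨h.1, ?_⟩⟩,
    ⟨fun h => resolventConv_of_cond hι h.1 h.2,
      fun h => ⟨h.condF1 hι, (h.condF2 hι).condF2Prime hι _⟩⟩,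
    ⟨fun h => h.semigroupConv hι, fun h => h.resolventConv hι⟩⟩,
    fun h => resolventConv_of_cond hι (h.1.mono hle) (h.2.mono hle)⟩
  exact (resolventConv_of_cond hι h.1 h.2).condF2 hι
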